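/- Let $G$ be a finite directed graph with vertex set $\mathcal V$ and edge set $\mathcal E$ (loops and multiple edges allowed); $s(e)$ and $r(e)$ denote the initial and the final vertex of $e\in\mathcal E$, and $A_G(u,v)$ is the number of edges from $u$ to $v$. Let $\mathcal E^-=\{e^-\}$ and $\mathcal E^+=\{e^+\}$ be two disjoint copies of $\mathcal E$. The graph inverse semigroup of $G$ is the semigroup with zero generated by $\mathcal E^-\cup\{P_v:v\in\mathcal V\}\cup\mathcal E^+$ with the relations $P_v^2=P_v$, $P_uP_v=0$ for $u\neq v$, $P_{s(e)}e^-=e^-=e^-P_{r(e)}$, $P_{r(e)}e^+=e^+=e^+P_{s(e)}$, $f^-f^+=P_{s(f)}$, and $f^-g^+=0$ for $f\ne g$. The Markov-Dyck shift $D_G$ is the set of all $x\in(\mathcal E^-\cup\mathcal E^+)^{\mathbb Z}$ every finite subword of which has non-zero product in this semigroup. With $\Pi_n$ the number of $x\in D_G$ fixed by the $n$-th power of the shift, its zeta function is the formal power series $\zeta_{D_G}(z)=\exp\big(\sum_{n\ge1}\Pi_n z^n/n\big)\in\mathbb Q[[z]]$. For a language $\mathcal L$ let $g_{\mathcal L}(z)=\sum_{n\ge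 0}\operatorname{card}\{w\in\mathcal L:\ell(w)=n\}\,z^n$, where $\ell(w)$ is the length of $w$. For $v\in\mathcal V$ the Markov-Dyck code $\mathcal C_v$ is the set of non-empty words over $\mathcal E^-\cup\mathcal E^+$ with product $P_v$ none of whose non-empty proper prefixes has product $P_v$, and $\mathcal C_v^*$ is the set of all finite (possibly empty) concatenations of words in $\mathcal C_v$. Let $D(A_G,z)$ and $D^*(A_G,z)$ be the diagonal $\mathcal V\times\mathcal V$ matrices with entries $g_{\mathcal C_v}(z)$ and $g_{\mathcal C_v^*}(z)$, $v\in\mathcal V$, respectively. **Theorem.** The series $1-g_{\mathcal C_v}(z)$, $v \in \mathcal V$, are invertible in $\mathbb Q[[z]]$, with $g_{\mathcal C_v^*}(z)=\dfrac1{1-g_{\mathcal C_v}(z)}$; the determinants in the denominators below are invertible in $\mathbb Q[[z]]$; and $$\zeta_{D_G}(z)=\frac{1}{\det\big((I-D(A_G,z)-A_Gz)(I-D^*(A_G,z)A_Gz)\big)}=\frac{\det D^*(A_G,z)}{\det\big(I-D^*(A_G,z)A_Gz\big)^2}.$$ -/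

import Mathlib

open scoped PowerSeries

noncomputable section

namespace MarkovDyck

universe u v

/-- A directed graph with vertex set `V` and edge set `E` (loops and multiple edges are allowed);
`s e` is the initial vertex and `r e` the final vertex of the edge `e`. -/
structure DirectedGraph (V : Type u) (E : Type v) where
  s : E → V
  r : E → V

/-- The alphabet `E⁻ ∪ E⁺`, the disjoint union of two copies of the edge set. -/
inductive Letter (E : Type v) : Type v
  | neg (e : E) : Letter E
  | pos (e : E) : Letter E

/-- The generating set `E⁻ ∪ {P_v : v ∈ V} ∪ E⁺` of the graph inverse semigroup. -/
inductive Generator (V : Type u) (E : Type v) : Type (max u v)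
  | idem (a : V) : Generator V E
  | letter (x : Letter E) : Generator V E

variable {V : Type u} {E : Type v}

/-- The free semigroup with zero on the generating set. -/
abbrev FreeSemigroupWithZero (V : Type u) (E : Type v) : Type (max u v) :=
  WithZero (FreeSemigroup (Generator V E))

/-- The generator `P_a` in the free semigroup with zero. -/
def freeIdem (E : Type v) (a : V) : FreeSemigroupWithZero V E :=
  ((FreeSemigroup.of (Generator.idem a) : FreeSemigroup (Generator V E)) : WithZero _)

/-- The generator `e⁻` in the free semigroup with zero. -/
def freeNeg (V : Type u) (e : E) : FreeSemigroupWithZero V E :=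
  ((FreeSemigroup.of (Generator.letter (Letter.neg e)) : FreeSemigroup (Generator V E)) :
    WithZero _)

/-- The generator `e⁺` in the free semigroup with zero. -/
def freePos (V : Type u) (e : E) : FreeSemigroupWithZero V E :=
  ((FreeSemigroup.of (Generator.letter (Letter.pos e)) : FreeSemigroup (Generator V E)) :
    WithZero _)

/-- The defining relations of the graph inverse semigroup of `G`. The relations `f⁻ g⁻ = 0` for
`r f ≠ s g`, `g⁺ f⁻ = 0` for `s f ≠ s g` and `f⁺ g⁺ = 0` for `s f ≠ r g` follow from these. -/
inductive Rel (G : DirectedGraph V E) :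
    FreeSemigroupWithZero V E → FreeSemigroupWithZero V E → Prop
  | idem_idem (a : V) : Rel G (freeIdem E a * freeIdem E a) (freeIdem E a)
  | idem_ne (a b : V) : a ≠ b → Rel G (freeIdem E a * freeIdem E b) 0
  | idem_neg (e : E) : Rel G (freeIdem E (G.s e) * freeNeg V e) (freeNeg V e)
  | neg_idem (e : E) : Rel G (freeNeg V e * freeIdem E (G.r e)) (freeNeg V e)
  | idem_pos (e : E) : Rel G (freeIdem E (G.r e) * freePos V e) (freePos V e)
  | pos_idem (e : E) : Rel G (freePos V e * freeIdem E (G.s e)) (freePos V e)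
  | neg_pos (e : E) : Rel G (freeNeg V e * freePos V e) (freeIdem E (G.s e))
  | neg_pos_ne (f g : E) : f ≠ g → Rel G (freeNeg V f * freePos V g) 0

/-- The graph inverse semigroup of `G`: the semigroup with zero given by the generators and
relations above. -/
def GraphInverseSemigroup (G : DirectedGraph V E) : Type (max u v) :=
  (conGen (Rel G)).Quotient

/-- The quotient map from the free semigroup with zero. -/
def GraphInverseSemigroup.mk (G : DirectedGraph V E) (x : FreeSemigroupWithZero V E) :
    GraphInverseSemigroup G :=
  ((x : (conGen (Rel G)).Quotient))

instance (G : DirectedGraph V E) : SemigroupWithZero (GraphInverseSemigroup G) where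
  toSemigroup := inferInstanceAs (Semigroup (conGen (Rel G)).Quotient)
  zero := GraphInverseSemigroup.mk G 0
  zero_mul := by
    rintro ⟨x⟩
    exact congrArg (GraphInverseSemigroup.mk G) (zero_mul x)
  mul_zero := by
    rintro ⟨x⟩
    exact congrArg (GraphInverseSemigroup.mk G) (mul_zero x)

namespace DirectedGraph

variable (G : DirectedGraph V E)

/-- The idempotent `P_a` of the graph inverse semigroup. -/
def idem (a : V) : GraphInverseSemigroup G :=
  GraphInverseSemigroup.mk G (freeIdem E a)

/-- The letter `e⁻` or `e⁺` as an element of the graph inverse semigroup. -/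
def letter : Letter E → GraphInverseSemigroup G
  | .neg e => GraphInverseSemigroup.mk G (freeNeg V e)
  | .pos e => GraphInverseSemigroup.mk G (freePos V e)

/-- The product of the letters of a word. A semigroup has no empty product, so the product is
taken after a unit has been adjoined to the graph inverse semigroup; the empty word has
the new unit as its value, which is neither `0` nor one of the `P_a`. -/
def wordProd (w : List (Letter E)) : WithOne (GraphInverseSemigroup G) :=
  (w.map fun x => ((G.letter x : GraphInverseSemigroup G) : WithOne _)).prod

/-- A word over `E⁻ ∪ E⁺` is admissible if its product in the graph inverse semigroup is not
zero. -/
def Admissible (w : List (Letter E)) : Prop :=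
  G.wordProd w ≠ ((0 : GraphInverseSemigroup G) : WithOne _)

/-- The Markov-Dyck shift of `G`: the bi-infinite sequences over `E⁻ ∪ E⁺` all of whose finite
subwords are admissible. -/
def shift : Set (ℤ → Letter E) :=
  {x | ∀ (i : ℤ) (k : ℕ), G.Admissible (List.ofFn fun j : Fin k => x (i + (j : ℕ)))}

/-- The Markov-Dyck code of the vertex `a`: the words with product `P_a` none of whose
non-empty proper prefixes has product `P_a`. (The empty word does not belong to it.) -/
def code (a : V) : Language (Letter E) :=
  {w | G.wordProd w = ((G.idem a : GraphInverseSemigroup G) : WithOne _) ∧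
    ∀ J : ℕ, 1 ≤ J → J < w.length →
      G.wordProd (w.take J) ≠ ((G.idem a : GraphInverseSemigroup G) : WithOne _)}

/-- The adjacency matrix: the entry at `(a, b)` is the number of edges from `a` to `b`. -/
def adjMatrix : Matrix V V ℕ :=
  Matrix.of fun a b => {e : E | G.s e = a ∧ G.r e = b}.ncard

end DirectedGraph

/-- The generating function of a formal language: its `n`-th coefficient is the number of words of
length `n` in the language. -/
def genFun {α : Type*} (L : Language α) : ℚ⟦X⟧ :=
  PowerSeries.mk fun n => ({w : List α | w ∈ L ∧ w.length = n}.ncard : ℚ)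

/-- The number of points of period `n` (that is, fixed by the `n`-th power of the left shift) of
a set of bi-infinite sequences. -/
def periodicCount {α : Type*} (S : Set (ℤ → α)) (n : ℕ) : ℕ :=
  {x : ℤ → α | x ∈ S ∧ ∀ i : ℤ, x (i + n) = x i}.ncard

/-- The formal power series `∑_{n ≥ 1} Π_n zⁿ / n`; the coefficient at `n = 0` is zero. -/
def logZeta {α : Type*} (S : Set (ℤ → α)) : ℚ⟦X⟧ :=
  PowerSeries.mk fun n => if n = 0 then 0 else (periodicCount S n : ℚ) / (n : ℚ)

/-- The zeta function `exp (∑_{n ≥ 1} Π_n zⁿ / n)` of a subshift as a formal power series. The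
substitution is legitimate because the inner series has constant coefficient zero. -/
def zeta {α : Type*} (S : Set (ℤ → α)) : ℚ⟦X⟧ :=
  (PowerSeries.exp ℚ).subst (logZeta S)

namespace DirectedGraph

variable (G : DirectedGraph V E)

/-- The matrix `A_G z`. -/
def adjMatrixZ : Matrix V V ℚ⟦X⟧ :=
  Matrix.of fun a b => (G.adjMatrix a b : ℚ⟦X⟧) * PowerSeries.X

variable [DecidableEq V]

/-- The diagonal matrix `D(A_G, z)` of the generating functions of the Markov-Dyck codes. -/
def dMatrix : Matrix V V ℚ⟦X⟧ :=
  Matrix.diagonal fun a => genFun (G.code a)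

/-- The diagonal matrix `D*(A_G, z)` of the generating functions of the languages `C_a*` of all
finite concatenations (the empty one included) of words of the Markov-Dyck codes. -/
def dStarMatrix : Matrix V V ℚ⟦X⟧ :=
  Matrix.diagonal fun a => genFun (KStar.kstar (G.code a))

end DirectedGraph

end MarkovDyck

end

/-! The semigroup acts on pairs (vertex, stack of edges): `e⁻` pushes `e` and `e⁺` pops it. Every
non-zero product has a normal form "pop `p`, then push `q`", so the action detects zero and the
`P_a`; admissibility and the codes become statements about runs (`admissible_iff`,
`wordProd_eq_idem_iff`).

Let `e⁻` have height 1 and `e⁺` height -1. A path read from the empty stack has only prefixes of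
height ≥ 0 (it is dominant). Cut a non-empty path at the first positive position, `gap`, from which
the rest is again dominant: the initial piece is either one edge that is never popped or a code
word. Hence (1 - M) F = 1, where F counts paths and M initial pieces (`one_sub_mul_pathsMatrix`).
For all paths M = D + Az; for paths of height 0, M = D and F = D*.

Cut a periodic point whose height over a period is ≥ 0 at the last position ≤ 0 below whose height
it never falls afterwards. This yields a closed path w and an offset j < `gap w`, so such points
number ∑ `gap w` (`ncard_periodicPoints`). The series of these numbers is z tr(M' F), which by
Jacobi's formula is -z (log det(1 - M))'.

Time reversal changes the sign of the height, so Π_n = 2 a_n - b_n, where a_n counts the points of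
height ≥ 0 and b_n those of height 0. Therefore ζ = det(1 - D) / det(1 - D - Az)², and 1 - D - Az =
(1 - D)(1 - D* Az) gives both forms of the theorem. -/

namespace MarkovDyck

/-! ### The stack machine as a representation of the semigroup -/

/-- Binary relations on the configurations (current vertex, stack of open edges) of the stack
machine of a graph. -/
def StackRel (V E : Type*) : Type _ := V × List E → V × List E → Prop

instance (V E : Type*) : SemigroupWithZero (StackRel V E) where
  mul p q := Relation.Comp p q
  mul_assoc _ _ _ := Relation.comp_assoc
  zero := fun _ _ => False
  zero_mul p := by
    funext s t
    exact propext ⟨fun ⟨_, h, _⟩ => h, fun h => h.elim⟩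
  mul_zero p := by
    funext s t
    exact propext ⟨fun ⟨_, _, h⟩ => h, fun h => h.elim⟩

variable {V E : Type*}

theorem StackRel.mul_apply (p q : StackRel V E) (s t : V × List E) :
    (p * q) s t ↔ ∃ m, p s m ∧ q m t := Iff.rfl

theorem StackRel.zero_apply (s t : V × List E) : ¬ (0 : StackRel V E) s t := id

namespace DirectedGraph

variable (G : DirectedGraph V E)

/-- The idempotent `P_a` acts as the identity on configurations at the vertex `a`. -/
def idemRel (E : Type*) (a : V) : StackRel V E := fun s t => s.1 = a ∧ t = s

/-- The letter `e⁻` pushes `e` on the stack, and `e⁺` pops it. -/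
def Step : Letter E → StackRel V E
  | .neg e => fun s t => ∃ l, s = (G.s e, l) ∧ t = (G.r e, e :: l)
  | .pos e => fun s t => ∃ l, s = (G.r e, e :: l) ∧ t = (G.s e, l)

/-- Reading a word with the stack machine. -/
def Run : List (Letter E) → V × List E → V × List E → Prop
  | [] => fun s t => s = t
  | x :: w => fun s t => ∃ m, G.Step x s m ∧ Run w m t

theorem step_neg_iff {e : E} {s t : V × List E} :
    G.Step (.neg e) s t ↔ ∃ l, s = (G.s e, l) ∧ t = (G.r e, e :: l) := Iff.rfl

theorem step_pos_iff {e : E} {s t : V × List E} :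
    G.Step (.pos e) s t ↔ ∃ l, s = (G.r e, e :: l) ∧ t = (G.s e, l) := Iff.rfl

@[simp] theorem run_nil {s t : V × List E} : G.Run [] s t ↔ s = t := Iff.rfl

theorem run_cons {x : Letter E} {w : List (Letter E)} {s t : V × List E} :
    G.Run (x :: w) s t ↔ ∃ m, G.Step x s m ∧ G.Run w m t := Iff.rfl

theorem run_append {w w' : List (Letter E)} {s t : V × List E} :
    G.Run (w ++ w') s t ↔ ∃ m, G.Run w s m ∧ G.Run w' m t := by
  induction w generalizing s with
  | nil => simp
  | cons x w ih =>
    simp only [List.cons_append, run_cons, ih]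
    constructor
    · rintro ⟨m, h, m', h1, h2⟩
      exact ⟨m', ⟨m, h, h1⟩, h2⟩
    · rintro ⟨m', ⟨m, h, h1⟩, h2⟩
      exact ⟨m, h, m', h1, h2⟩

/-- The stack machine as a representation of the free semigroup with zero. -/
def freeRep : FreeSemigroupWithZero V E →ₙ* StackRel V E where
  toFun := WithZero.recZeroCoe 0 (FreeSemigroup.lift fun
    | Generator.idem a => idemRel E a
    | Generator.letter x => G.Step x)
  map_mul' x y := by
    induction x using WithZero.recZeroCoe with
    | zero => simp
    | coe x =>
      induction y using WithZero.recZeroCoe with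
      | zero => simp
      | coe y =>
        rw [← WithZero.coe_mul]
        simp only [WithZero.recZeroCoe_coe, map_mul]

theorem freeRep_idem (a : V) : G.freeRep (freeIdem E a) = idemRel E a := rfl

theorem freeRep_neg (e : E) : G.freeRep (freeNeg V e) = G.Step (.neg e) := rfl

theorem freeRep_pos (e : E) : G.freeRep (freePos V e) = G.Step (.pos e) := rfl

theorem freeRep_zero : G.freeRep 0 = 0 := rfl

/-- The only relations with content are the last two: after pushing `f` the top of the stack is `f`,
so popping `g` succeeds only for `g = f`, and then restores the configuration. -/
theorem freeRep_rel {x y : FreeSemigroupWithZero V E} (h : Rel G x y) :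
    G.freeRep x = G.freeRep y := by
  induction h <;> simp only [map_mul, freeRep_idem, freeRep_neg, freeRep_pos, freeRep_zero] <;>
    funext s t <;> refine propext ?_ <;>
    simp only [StackRel.mul_apply, idemRel, step_neg_iff, step_pos_iff]
  case idem_idem a => aesop
  case idem_ne a b h =>
    refine ⟨?_, fun h => h.elim⟩
    rintro ⟨m, ⟨rfl, rfl⟩, h', -⟩
    exact (h h').elim
  case neg_pos_ne f g h =>
    refine ⟨?_, fun h => h.elim⟩
    rintro ⟨m, ⟨l, rfl, rfl⟩, l', h', -⟩
    simp at h'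
    exact (h h'.2.1).elim
  case neg_pos e =>
    constructor
    · rintro ⟨m, ⟨l, rfl, rfl⟩, l', h', rfl⟩
      simp_all
    · rintro ⟨h, rfl⟩
      obtain ⟨a, l⟩ := t
      obtain rfl : a = G.s e := h
      exact ⟨_, ⟨l, rfl, rfl⟩, l, rfl, rfl⟩
  all_goals
    constructor
    · rintro ⟨m, h1, h2⟩
      aesop
    · rintro ⟨l, rfl, rfl⟩
      aesop

/-- The stack machine as a representation of the graph inverse semigroup. -/
def rep : GraphInverseSemigroup G → StackRel V E :=
  Quotient.lift G.freeRep fun _ _ h =>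
    (Con.conGen_le (c := Con.ker G.freeRep)).2 (fun _ _ h => G.freeRep_rel h) h

theorem mk_rel {x y : FreeSemigroupWithZero V E} (h : Rel G x y) :
    GraphInverseSemigroup.mk G x = GraphInverseSemigroup.mk G y :=
  Quotient.sound (ConGen.Rel.of _ _ h)

theorem rep_mul (x y : GraphInverseSemigroup G) : G.rep (x * y) = G.rep x * G.rep y := by
  obtain ⟨x, rfl⟩ := Quotient.exists_rep x
  obtain ⟨y, rfl⟩ := Quotient.exists_rep y
  exact map_mul G.freeRep x y

theorem rep_zero : G.rep 0 = 0 := rfl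

theorem rep_idem (a : V) : G.rep (G.idem a) = idemRel E a := rfl

theorem rep_letter (x : Letter E) : G.rep (G.letter x) = G.Step x := by
  cases x <;> rfl

theorem idem_mul_idem (a : V) : G.idem a * G.idem a = G.idem a := G.mk_rel (.idem_idem a)

theorem idem_mul_idem_of_ne {a b : V} (h : a ≠ b) : G.idem a * G.idem b = 0 :=
  G.mk_rel (.idem_ne a b h)

theorem idem_mul_neg (e : E) : G.idem (G.s e) * G.letter (.neg e) = G.letter (.neg e) :=
  G.mk_rel (.idem_neg e)

theorem neg_mul_idem (e : E) : G.letter (.neg e) * G.idem (G.r e) = G.letter (.neg e) :=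
  G.mk_rel (.neg_idem e)

theorem idem_mul_pos (e : E) : G.idem (G.r e) * G.letter (.pos e) = G.letter (.pos e) :=
  G.mk_rel (.idem_pos e)

theorem pos_mul_idem (e : E) : G.letter (.pos e) * G.idem (G.s e) = G.letter (.pos e) :=
  G.mk_rel (.pos_idem e)

theorem neg_mul_pos (e : E) : G.letter (.neg e) * G.letter (.pos e) = G.idem (G.s e) :=
  G.mk_rel (.neg_pos e)

theorem neg_mul_pos_of_ne {f g : E} (h : f ≠ g) : G.letter (.neg f) * G.letter (.pos g) = 0 :=
  G.mk_rel (.neg_pos_ne f g h)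

/-! ### Normal forms, and what the action detects -/

/-- `NF G x c p v q` says that `x` is the non-zero element of the graph inverse semigroup in normal
form that starts at `c`, pops the edges of `p` (the last one first in the list), and then pushes
the edges of `q` (the last one first in the list), ending at `v`. -/
inductive NF : GraphInverseSemigroup G → V → List E → V → List E → Prop
  | idem (c : V) : NF (G.idem c) c [] c []
  | pop {x c p} (e : E) : NF x c p (G.r e) [] → NF (x * G.letter (.pos e)) c (e :: p) (G.s e) []
  | push {x c p q} (e : E) :
      NF x c p (G.s e) q → NF (x * G.letter (.neg e)) c p (G.r e) (e :: q)

variable {G}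

theorem NF.mul_idem {x : GraphInverseSemigroup G} {c v : V} {p q : List E} (h : G.NF x c p v q) :
    x * G.idem v = x := by
  cases h with
  | idem => exact G.idem_mul_idem _
  | pop e _ => rw [mul_assoc, pos_mul_idem]
  | push e _ => rw [mul_assoc, neg_mul_idem]

/-- The action determines the normal form. In particular a normal form acts as a non-empty relation,
hence is not zero. -/
theorem NF.rep_iff {x : GraphInverseSemigroup G} {c v : V} {p q : List E} (h : G.NF x c p v q)
    (s t : V × List E) : G.rep x s t ↔ ∃ l, s = (c, p.reverse ++ l) ∧ t = (v, q ++ l) := by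
  induction h generalizing t with
  | idem c =>
    rw [rep_idem]
    constructor
    · rintro ⟨h, rfl⟩
      exact ⟨t.2, Prod.ext h rfl, Prod.ext h rfl⟩
    · rintro ⟨l, rfl, rfl⟩
      exact ⟨rfl, rfl⟩
  | pop e _ ih =>
    rw [rep_mul, StackRel.mul_apply, rep_letter]
    constructor
    · rintro ⟨m, h1, l', h2, rfl⟩
      obtain ⟨l, rfl, rfl⟩ := (ih _).1 h1
      simp at h2
      exact ⟨l', by simp [h2], rfl⟩
    · rintro ⟨l, rfl, rfl⟩
      exact ⟨_, (ih _).2 ⟨e :: l, by simp, rfl⟩, l, rfl, rfl⟩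
  | push e _ ih =>
    rw [rep_mul, StackRel.mul_apply, rep_letter]
    constructor
    · rintro ⟨m, h1, l', h2, rfl⟩
      obtain ⟨l, rfl, rfl⟩ := (ih _).1 h1
      simp at h2
      exact ⟨l, rfl, by simp [h2]⟩
    · rintro ⟨l, rfl, rfl⟩
      exact ⟨_, (ih _).2 ⟨l, rfl, rfl⟩, _, rfl, rfl⟩

theorem NF.pop_of_eq {x : GraphInverseSemigroup G} {c v : V} {p : List E} (h : G.NF x c p v [])
    {e : E} (hv : v = G.r e) : G.NF (x * G.letter (.pos e)) c (e :: p) (G.s e) [] := by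
  subst hv
  exact h.pop e

/-- A mismatch of vertices gives zero through `P_u P_v = 0`. Otherwise a push extends `q`, while a
pop cancels the head of `q` or, if `q` is empty, extends `p`. -/
theorem NF.mul_letter {x : GraphInverseSemigroup G} {c v : V} {p q : List E} (h : G.NF x c p v q)
    (y : Letter E) : x * G.letter y = 0 ∨ ∃ p' v' q', G.NF (x * G.letter y) c p' v' q' := by
  cases y with
  | neg e =>
    by_cases hv : v = G.s e
    · subst hv
      exact .inr ⟨_, _, _, h.push e⟩
    · left
      rw [← h.mul_idem, ← idem_mul_neg, mul_assoc, ← mul_assoc (G.idem v),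
        idem_mul_idem_of_ne G hv, zero_mul, mul_zero]
  | pos e =>
    by_cases hv : v = G.r e
    · cases h with
      | idem c => exact .inr ⟨_, _, _, (NF.idem c).pop_of_eq hv⟩
      | pop f h' => exact .inr ⟨_, _, _, (h'.pop f).pop_of_eq hv⟩
      | push f h' =>
        by_cases hf : f = e
        · subst hf
          right
          rw [mul_assoc, neg_mul_pos, h'.mul_idem]
          exact ⟨_, _, _, h'⟩
        · left
          rw [mul_assoc, neg_mul_pos_of_ne G hf, mul_zero]
    · left
      rw [← h.mul_idem, ← idem_mul_pos, mul_assoc, ← mul_assoc (G.idem v),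
        idem_mul_idem_of_ne G hv, zero_mul, mul_zero]

theorem exists_idem_mul_letter (x : Letter E) : ∃ a, G.idem a * G.letter x = G.letter x := by
  cases x with
  | neg e => exact ⟨_, G.idem_mul_neg e⟩
  | pos e => exact ⟨_, G.idem_mul_pos e⟩

variable (G)

theorem exists_wordProd_eq (x : Letter E) (w : List (Letter E)) :
    ∃ y : GraphInverseSemigroup G, G.wordProd (x :: w) = (y : WithOne _) ∧
      G.rep y = G.Run (x :: w) ∧ (y = 0 ∨ ∃ c p v q, G.NF y c p v q) := by
  induction w using List.reverseRecOn with
  | nil =>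
    refine ⟨G.letter x, by simp [wordProd], ?_, ?_⟩
    · rw [rep_letter]
      funext s t
      simp [run_cons]
    · obtain ⟨a, ha⟩ := exists_idem_mul_letter (G := G) x
      rw [← ha]
      exact (NF.idem a).mul_letter x |>.imp_right fun ⟨p, v, q, h⟩ => ⟨a, p, v, q, h⟩
  | append_singleton w z ih =>
    obtain ⟨y, h1, h2, h3⟩ := ih
    refine ⟨y * G.letter z, ?_, ?_, ?_⟩
    · rw [WithOne.coe_mul, ← h1]
      simp [wordProd, mul_assoc]
    · rw [rep_mul, h2, rep_letter]
      funext s t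
      rw [← List.cons_append]
      refine propext (Iff.trans ?_ (run_append G).symm)
      refine exists_congr fun m => and_congr_right fun _ => ?_
      simp only [run_cons, run_nil, exists_eq_right]
    · rcases h3 with rfl | ⟨c, p, v, q, h⟩
      · exact .inl (zero_mul _)
      · exact h.mul_letter z |>.imp_right fun ⟨p, v, q, h⟩ => ⟨c, p, v, q, h⟩

theorem admissible_iff (w : List (Letter E)) :
    G.Admissible w ↔ w = [] ∨ ∃ s t, G.Run w s t := by
  cases w with
  | nil => simp [Admissible, wordProd, WithOne.one_ne_coe]
  | cons x w =>
    obtain ⟨y, h1, h2, h3⟩ := G.exists_wordProd_eq x w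
    rw [Admissible, h1, ← h2]
    simp only [ne_eq, WithOne.coe_inj, reduceCtorEq, false_or]
    rcases h3 with rfl | ⟨c, p, v, q, h⟩
    · simp [rep_zero, StackRel.zero_apply]
    · have : G.rep y (c, p.reverse ++ []) (v, q ++ []) := (h.rep_iff _ _).2 ⟨[], rfl, rfl⟩
      refine iff_of_true ?_ ⟨_, _, this⟩
      rintro rfl
      exact this

theorem run_closed {w : List (Letter E)} {u v : V} (h : G.Run w (u, []) (v, [])) : u = v := by
  cases w with
  | nil => simpa using h
  | cons x w =>
    obtain ⟨y, h1, h2, h3⟩ := G.exists_wordProd_eq x w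
    rw [← h2] at h
    rcases h3 with rfl | ⟨c, p, b, q, h'⟩
    · exact h.elim
    · obtain ⟨l, e1, e2⟩ := (h'.rep_iff _ _).1 h
      simp at e1 e2
      obtain ⟨rfl, rfl, rfl⟩ := e1
      obtain ⟨rfl, rfl, -⟩ := e2
      cases h'
      rfl

theorem wordProd_eq_idem_iff {w : List (Letter E)} {a : V} :
    G.wordProd w = ((G.idem a : GraphInverseSemigroup G) : WithOne _) ↔
      w ≠ [] ∧ G.Run w (a, []) (a, []) := by
  cases w with
  | nil => simp [wordProd, WithOne.one_ne_coe]
  | cons x w =>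
    obtain ⟨y, h1, h2, h3⟩ := G.exists_wordProd_eq x w
    rw [h1, ← h2]
    simp only [WithOne.coe_inj, ne_eq, reduceCtorEq, not_false_eq_true, true_and]
    constructor
    · rintro rfl
      exact ⟨rfl, rfl⟩
    · intro h
      -- Starting and ending with the empty stack forces `p = q = []`, and the only such normal form
      -- is an idempotent.
      rcases h3 with rfl | ⟨c, p, b, q, h'⟩
      · exact h.elim
      · obtain ⟨l, e1, e2⟩ := (h'.rep_iff _ _).1 h
        simp at e1 e2
        obtain ⟨rfl, rfl, rfl⟩ := e1
        obtain ⟨rfl, rfl, -⟩ := e2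
        cases h'
        rfl

end DirectedGraph

/-! ### Heights and initial pieces of words -/

/-- The height of a letter: `e⁻` raises the stack and `e⁺` lowers it. -/
def Letter.ht : Letter E → ℤ
  | .neg _ => 1
  | .pos _ => -1

/-- The total height of a word. -/
def ht (w : List (Letter E)) : ℤ := (w.map Letter.ht).sum

@[simp] theorem ht_nil : ht ([] : List (Letter E)) = 0 := rfl

theorem ht_cons (x : Letter E) (w : List (Letter E)) : ht (x :: w) = x.ht + ht w := by
  simp [ht]

theorem ht_append (w w' : List (Letter E)) : ht (w ++ w') = ht w + ht w' := by
  simp [ht]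

/-- A word all of whose prefixes have non-negative height. -/
def Dominant (w : List (Letter E)) : Prop := ∀ k, 0 ≤ ht (w.take k)

theorem Dominant.ht_nonneg {w : List (Letter E)} (h : Dominant w) : 0 ≤ ht w := by
  simpa using h w.length

theorem dominant_nil : Dominant ([] : List (Letter E)) := by
  intro k
  simp

/-- The length of the initial piece of a word, that is, the least positive position from which
the word continues as a dominant word. -/
noncomputable def gap (w : List (Letter E)) : ℕ := sInf {k | 1 ≤ k ∧ Dominant (w.drop k)}

theorem gap_spec (w : List (Letter E)) : 1 ≤ gap w ∧ Dominant (w.drop (gap w)) :=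
  Nat.sInf_mem (s := {k | 1 ≤ k ∧ Dominant (w.drop k)})
    ⟨w.length + 1, by simp, by simpa [List.drop_of_length_le] using dominant_nil⟩

theorem gap_le {w : List (Letter E)} {k : ℕ} (hk : 1 ≤ k) (h : Dominant (w.drop k)) :
    gap w ≤ k := Nat.sInf_le ⟨hk, h⟩

theorem gap_le_length {w : List (Letter E)} (hw : w ≠ []) : gap w ≤ w.length :=
  gap_le (List.length_pos_of_ne_nil hw) (by simpa using dominant_nil)

theorem ht_take_add (w : List (Letter E)) (j t : ℕ) :
    ht (w.take (j + t)) = ht (w.take j) + ht ((w.drop j).take t) := by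
  rw [List.take_add, ht_append]

theorem dominant_drop_iff {w : List (Letter E)} {j : ℕ} :
    Dominant (w.drop j) ↔ ∀ t, j ≤ t → ht (w.take j) ≤ ht (w.take t) := by
  constructor
  · intro h t ht'
    obtain ⟨t, rfl⟩ := Nat.exists_eq_add_of_le ht'
    rw [ht_take_add]
    linarith [h t]
  · intro h t
    have := h (j + t) (Nat.le_add_right _ _)
    rw [ht_take_add] at this
    linarith

/-- No position strictly between 0 and `gap w` starts a dominant suffix, so from each one some later
position is strictly lower. Iterating leads to a position at or beyond `gap w`, where the height is
at least that at `gap w`. -/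
theorem ht_take_gap_lt (w : List (Letter E)) {j : ℕ} (hj : 1 ≤ j) (hj' : j < gap w) :
    ht (w.take (gap w)) < ht (w.take j) := by
  induction hd : gap w - j using Nat.strong_induction_on generalizing j with
  | _ d ih =>
    have : ¬ Dominant (w.drop j) := fun h => absurd (gap_le hj h) (by omega)
    rw [dominant_drop_iff] at this
    push Not at this
    obtain ⟨t, h1, h2⟩ := this
    have hne : j ≠ t := by rintro rfl; exact lt_irrefl _ h2
    rcases lt_or_ge t (gap w) with h3 | h3
    · exact (ih (gap w - t) (by omega) (by omega) h3 rfl).trans h2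
    · exact (dominant_drop_iff.1 (gap_spec w).2 t h3).trans_lt h2

/-! ### Paths, code words and the shape of the initial piece -/

namespace DirectedGraph

variable (G : DirectedGraph V E)

/-- The vertex at which a letter is read. -/
def src : Letter E → V
  | .neg e => G.s e
  | .pos e => G.r e

variable {G}

theorem Step.length {x : Letter E} {s t : V × List E} (h : G.Step x s t) :
    (t.2.length : ℤ) = s.2.length + x.ht := by
  cases x <;> obtain ⟨l, rfl, rfl⟩ := h <;> simp [Letter.ht]

theorem Run.length {w : List (Letter E)} {s t : V × List E} (h : G.Run w s t) :
    (t.2.length : ℤ) = s.2.length + ht w := by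
  induction w generalizing s with
  | nil => obtain rfl := h; simp
  | cons x w ih =>
    obtain ⟨m, h1, h2⟩ := h
    rw [ih h2, h1.length, ht_cons]
    ring

theorem Run.append_stack {w : List (Letter E)} {a b : V} {l m : List E}
    (h : G.Run w (a, l) (b, m)) (l' : List E) : G.Run w (a, l ++ l') (b, m ++ l') := by
  induction w generalizing a l with
  | nil =>
    obtain ⟨rfl, rfl⟩ := Prod.mk.inj h
    rfl
  | cons x w ih =>
    obtain ⟨⟨c, k⟩, h1, h2⟩ := h
    refine ⟨(c, k ++ l'), ?_, ih h2⟩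
    cases x <;> obtain ⟨l0, h3, h4⟩ := h1 <;> obtain ⟨rfl, rfl⟩ := Prod.mk.inj h3 <;>
      obtain ⟨rfl, rfl⟩ := Prod.mk.inj h4 <;> exact ⟨_, rfl, rfl⟩

/-- Since the height never drops below the level of `l`, that part of the stack is never read and
may be removed. -/
theorem Run.change_base {w : List (Letter E)} {a b : V} {l₀ l m : List E}
    (h : G.Run w (a, l₀ ++ l) (b, m)) (hw : ∀ k, 0 ≤ (l₀.length : ℤ) + ht (w.take k)) :
    ∃ q, m = q ++ l ∧ G.Run w (a, l₀) (b, q) := by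
  induction w generalizing a l₀ with
  | nil =>
    obtain ⟨rfl, rfl⟩ := Prod.mk.inj h
    exact ⟨l₀, rfl, rfl⟩
  | cons x w ih =>
    obtain ⟨⟨c, k⟩, h1, h2⟩ := h
    cases x with
    | neg e =>
      obtain ⟨l', h3, h4⟩ := h1
      obtain ⟨rfl, rfl⟩ := Prod.mk.inj h3
      obtain ⟨rfl, rfl⟩ := Prod.mk.inj h4
      obtain ⟨q, hq, hr⟩ := ih (l₀ := e :: l₀) h2 fun k => by
        have := hw (k + 1)
        rw [List.take_succ_cons, ht_cons] at this
        simp only [Letter.ht, List.length_cons] at this ⊢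
        push_cast
        linarith
      exact ⟨q, hq, _, ⟨_, rfl, rfl⟩, hr⟩
    | pos e =>
      obtain ⟨l', h3, h4⟩ := h1
      obtain ⟨rfl, h5⟩ := Prod.mk.inj h3
      obtain ⟨rfl, rfl⟩ := Prod.mk.inj h4
      cases l₀ with
      | nil =>
        have := hw 1
        simp [ht_cons, Letter.ht] at this
      | cons f l₀ =>
        obtain ⟨rfl, rfl⟩ := List.cons.inj h5
        obtain ⟨q, hq, hr⟩ := ih h2 fun k => by
          have := hw (k + 1)
          rw [List.take_succ_cons, ht_cons] at this
          simp only [Letter.ht, List.length_cons] at this ⊢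
          push_cast at this
          linarith
        exact ⟨q, hq, _, ⟨_, rfl, rfl⟩, hr⟩

theorem Run.of_dominant {w : List (Letter E)} {a b : V} {l m : List E}
    (h : G.Run w (a, l) (b, m)) (hw : Dominant w) : ∃ q, m = q ++ l ∧ G.Run w (a, []) (b, q) :=
  Run.change_base (l₀ := []) h fun k => by simpa using hw k

theorem Run.dominant {w : List (Letter E)} {a : V} {t : V × List E} (h : G.Run w (a, []) t) :
    Dominant w := by
  intro k
  rw [← List.take_append_drop k w, run_append] at h
  obtain ⟨m, h1, -⟩ := h
  have := h1.length
  simp only [List.length_nil, Nat.cast_zero, zero_add] at this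
  omega

theorem Run.src {x : Letter E} {w : List (Letter E)} {a : V} {l : List E} {t : V × List E}
    (h : G.Run (x :: w) (a, l) t) : G.src x = a := by
  obtain ⟨_, h1, -⟩ := h
  cases x <;> obtain ⟨_, h1, -⟩ := h1 <;> exact (Prod.mk.inj h1).1.symm

variable (G)

/-- The words with height in `H` that lead from the vertex `u` to the vertex `v` without popping
an edge from the initial stack. -/
def paths (H : Set ℤ) (u v : V) : Language (Letter E) :=
  {w | (∃ q, G.Run w (u, []) (v, q)) ∧ ht w ∈ H}

variable {G}

theorem dominant_of_mem_paths {H : Set ℤ} {u v : V} {w : List (Letter E)}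
    (h : w ∈ G.paths H u v) : Dominant w := h.1.choose_spec.dominant

theorem run_append_paths {u a v : V} {w w' : List (Letter E)}
    (h : ∃ q, G.Run w (u, []) (a, q)) (h' : ∃ q, G.Run w' (a, []) (v, q)) :
    ∃ q, G.Run (w ++ w') (u, []) (v, q) := by
  obtain ⟨q, hq⟩ := h
  obtain ⟨q', hq'⟩ := h'
  exact ⟨q' ++ q, (run_append G).2 ⟨_, hq, by simpa using hq'.append_stack q⟩⟩

theorem mem_code {a : V} {w : List (Letter E)} : w ∈ G.code a ↔
    w ≠ [] ∧ G.Run w (a, []) (a, []) ∧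
      ∀ J, 1 ≤ J → J < w.length → ¬ G.Run (w.take J) (a, []) (a, []) := by
  change (_ ∧ _) ↔ _
  rw [wordProd_eq_idem_iff, and_assoc]
  refine and_congr_right fun hw => and_congr_right fun _ => forall_congr' fun J =>
    forall_congr' fun h1 => forall_congr' fun h2 => ?_
  rw [ne_eq, wordProd_eq_idem_iff, not_iff_not]
  refine and_iff_right ?_
  rw [ne_eq, List.take_eq_nil_iff]
  simp [hw]
  omega

theorem ht_eq_zero_of_mem_code {a : V} {c : List (Letter E)} (hc : c ∈ G.code a) : ht c = 0 := by
  have := (mem_code.1 hc).2.1.length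
  simpa using this.symm

theorem two_le_length_of_mem_code {a : V} {c : List (Letter E)} (hc : c ∈ G.code a) :
    2 ≤ c.length := by
  have h0 := ht_eq_zero_of_mem_code hc
  rcases c with - | ⟨x, - | ⟨y, c⟩⟩
  · exact absurd rfl (mem_code.1 hc).1
  · cases x <;> simp [ht_cons, Letter.ht] at h0
  · simp

/-- At an intermediate height 0 the stack would be empty, and `run_closed` would put the machine
back at `a`: a shorter prefix with product `P_a`. -/
theorem ht_take_pos_of_mem_code {a : V} {c : List (Letter E)} (hc : c ∈ G.code a) {j : ℕ}
    (h1 : 1 ≤ j) (h2 : j < c.length) : 0 < ht (c.take j) := by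
  obtain ⟨-, hr, hm⟩ := mem_code.1 hc
  refine lt_of_le_of_ne (hr.dominant j) fun h0 => hm j h1 h2 ?_
  rw [← List.take_append_drop j c, run_append] at hr
  obtain ⟨⟨b, l⟩, hr, -⟩ := hr
  have hl := hr.length
  rw [← h0] at hl
  simp only [List.length_nil, Nat.cast_zero, add_zero, Nat.cast_eq_zero,
    List.length_eq_zero_iff] at hl
  subst hl
  obtain rfl := G.run_closed hr
  exact hr

theorem gap_code_append {a : V} {c w : List (Letter E)} (hc : c ∈ G.code a) (hw : Dominant w) :
    gap (c ++ w) = c.length := by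
  refine le_antisymm (gap_le ((two_le_length_of_mem_code hc).trans' one_le_two) ?_) ?_
  · rwa [List.drop_left]
  · by_contra! h
    obtain ⟨h1, h2⟩ := gap_spec (c ++ w)
    have h3 := ht_take_pos_of_mem_code hc h1 h
    have h4 := dominant_drop_iff.1 h2 c.length h.le
    rw [List.take_left, List.take_append_of_le_length h.le, ht_eq_zero_of_mem_code hc] at h4
    omega

theorem gap_cons_of_dominant (x : Letter E) {w : List (Letter E)} (hw : Dominant w) :
    gap (x :: w) = 1 :=
  le_antisymm (gap_le le_rfl hw) (gap_spec _).1

/-- A non-empty path with initial piece of length one starts with an edge that is never popped. -/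
theorem exists_eq_cons_of_gap_eq_one {u v : V} {w : List (Letter E)} {q : List E}
    (h : G.Run w (u, []) (v, q)) (hw : w ≠ []) (hg : gap w = 1) :
    ∃ e w', G.s e = u ∧ (∃ q, G.Run w' (G.r e, []) (v, q)) ∧ w = .neg e :: w' := by
  cases w with
  | nil => exact absurd rfl hw
  | cons x w =>
    have hd := (gap_spec (x :: w)).2
    rw [hg, List.drop_one, List.tail_cons] at hd
    obtain ⟨m, h1, h2⟩ := h
    cases x with
    | pos e =>
      obtain ⟨l, h3, -⟩ := h1
      simp at h3
    | neg e =>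
      obtain ⟨l, h3, rfl⟩ := h1
      obtain ⟨rfl, rfl⟩ := Prod.mk.inj h3
      obtain ⟨q', -, h4⟩ := h2.of_dominant hd
      exact ⟨e, w, rfl, ⟨q', h4⟩, rfl⟩

/-- A non-empty path with a longer initial piece starts with a code word. -/
theorem exists_eq_append_of_gap_ne_one {u v : V} {w : List (Letter E)} {q : List E}
    (h : G.Run w (u, []) (v, q)) (hw : w ≠ []) (hg : gap w ≠ 1) :
    w.take (gap w) ∈ G.code u ∧ ∃ q, G.Run (w.drop (gap w)) (u, []) (v, q) := by
  obtain ⟨hg1, hd⟩ := gap_spec w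
  have hdom := h.dominant
  have hlen := gap_le_length hw
  -- The height at `gap w` is strictly below the height after one letter, which is at most 1;
  -- dominance gives the other inequality.
  have h0 : ht (w.take (gap w)) = 0 := by
    refine le_antisymm ?_ (hdom _)
    have h1 := ht_take_gap_lt w le_rfl (by omega : 1 < gap w)
    have h2 : ht (w.take 1) ≤ 1 := by
      rcases w with - | ⟨x, w⟩
      · simp
      · cases x <;> simp [ht_cons, Letter.ht]
    omega
  have hr := h
  rw [← List.take_append_drop (gap w) w, run_append] at hr
  obtain ⟨⟨b, l⟩, h1, h2⟩ := hr
  have hl := h1.length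
  rw [h0] at hl
  simp only [List.length_nil, Nat.cast_zero, add_zero, Nat.cast_eq_zero,
    List.length_eq_zero_iff] at hl
  subst hl
  obtain rfl := G.run_closed h1
  refine ⟨mem_code.2 ⟨?_, h1, ?_⟩, q, h2⟩
  · rw [ne_eq, List.take_eq_nil_iff]
    simp [hw]
    omega
  · intro J hJ hJ' hrun
    rw [List.length_take] at hJ'
    rw [List.take_take, min_eq_left (by omega)] at hrun
    have h3 := hrun.length
    have h4 := ht_take_gap_lt w hJ (by omega)
    simp at h3
    omega

end DirectedGraph

/-! ### Logarithmic derivatives of determinants and of the zeta function -/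

section Series

open PowerSeries Matrix

theorem derivation_prod {R A ι : Type*} [CommRing R] [CommRing A] [Algebra R A] [DecidableEq ι]
    (d : Derivation R A A) (s : Finset ι) (f : ι → A) :
    d (∏ i ∈ s, f i) = ∑ i ∈ s, (∏ j ∈ s.erase i, f j) * d (f i) := by
  induction s using Finset.induction_on with
  | empty => simp
  | insert a s ha ih =>
    rw [Finset.prod_insert ha, Derivation.leibniz, ih, Finset.sum_insert ha,
      Finset.erase_insert ha, smul_eq_mul, smul_eq_mul, add_comm, Finset.mul_sum]
    congr 1
    refine Finset.sum_congr rfl fun i hi => ?_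
    rw [Finset.erase_insert_of_ne (by rintro rfl; exact ha hi),
      Finset.prod_insert (by simp [ha]), mul_assoc]

/-- Jacobi's formula for the derivative of a determinant. -/
theorem derivation_det {R A n : Type*} [CommRing R] [CommRing A] [Algebra R A] [DecidableEq n]
    [Fintype n] (d : Derivation R A A) (M : Matrix n n A) :
    d M.det = (M.adjugate * M.map d).trace := by
  -- By Cramer's rule each diagonal entry is `det M` with column `i` differentiated; their sum is
  -- the Leibniz rule applied to the permutation expansion.
  have h : ∀ i, (M.adjugate * M.map d) i i = (M.updateCol i fun j => d (M j i)).det := by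
    intro i
    rw [← cramer_apply, cramer_eq_adjugate_mulVec]
    rfl
  simp only [trace, diag, h, det_apply, map_sum, Units.smul_def]
  rw [Finset.sum_comm]
  refine Finset.sum_congr rfl fun σ _ => ?_
  rw [map_zsmul, derivation_prod, ← Finset.smul_sum]
  congr 1
  refine Finset.sum_congr rfl fun i _ => ?_
  rw [← Finset.prod_erase_mul _ _ (Finset.mem_univ i)]
  congr 1
  · refine Finset.prod_congr rfl fun j hj => ?_
    rw [updateCol_ne (Finset.ne_of_mem_erase hj)]
  · rw [updateCol_self]

theorem derivative_det_one_sub {n : Type*} [DecidableEq n] [Fintype n] {M F : Matrix n n ℚ⟦X⟧}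
    (h : (1 - M) * F = 1) :
    d⁄dX ℚ (1 - M).det = -((1 - M).det * (M.map (d⁄dX ℚ) * F).trace) := by
  have hadj : (1 - M).adjugate = (1 - M).det • F := by
    calc (1 - M).adjugate = (1 - M).adjugate * ((1 - M) * F) := by rw [h, mul_one]
      _ = _ := by rw [← mul_assoc, adjugate_mul, smul_mul_assoc, one_mul]
  have hd : (1 - M).map (d⁄dX ℚ) = -M.map (d⁄dX ℚ) := by
    ext i j : 2
    simp [Matrix.one_apply, apply_ite]
  rw [derivation_det, hadj, hd, mul_neg, trace_neg, smul_mul_assoc, trace_smul, smul_eq_mul,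
    trace_mul_comm]

/-- The series `∑_{n ≥ 1} c_n zⁿ`. -/
def countSeries (c : ℕ → ℕ) : ℚ⟦X⟧ := PowerSeries.mk fun n => if n = 0 then 0 else (c n : ℚ)

theorem constantCoeff_logZeta {α : Type*} (S : Set (ℤ → α)) : constantCoeff (logZeta S) = 0 := by
  rw [← coeff_zero_eq_constantCoeff_apply, logZeta, coeff_mk, if_pos rfl]

theorem X_mul_derivative_zeta {α : Type*} (S : Set (ℤ → α)) :
    X * d⁄dX ℚ (zeta S) = zeta S * countSeries (periodicCount S) := by
  have hs : HasSubst (logZeta S) := HasSubst.of_constantCoeff_zero (constantCoeff_logZeta S)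
  have hl : X * d⁄dX ℚ (logZeta S) = countSeries (periodicCount S) := by
    ext n
    cases n with
    | zero => simp [countSeries]
    | succ n =>
      rw [coeff_succ_X_mul, coeff_derivative, logZeta, countSeries, coeff_mk, coeff_mk]
      have : (n : ℚ) + 1 ≠ 0 := by positivity
      simp [this]
  rw [zeta, derivative_subst hs, derivative_exp, ← hl]
  ring

theorem constantCoeff_zeta {α : Type*} (S : Set (ℤ → α)) : constantCoeff (zeta S) = 1 := by
  have hs : HasSubst (logZeta S) := HasSubst.of_constantCoeff_zero (constantCoeff_logZeta S)
  rw [← coeff_zero_eq_constantCoeff_apply, zeta, coeff_subst' hs, finsum_eq_single _ 0]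
  · simp
  · intro n hn
    simp [constantCoeff_logZeta, hn]

/-- If a counting sequence is `2 a - b`, where `a` and `b` are counted by logarithmic derivatives of
determinants, then the zeta function is the corresponding quotient. -/
theorem zeta_mul_det_sq {α n : Type*} [DecidableEq n] [Fintype n] (S : Set (ℤ → α))
    {M F M' F' : Matrix n n ℚ⟦X⟧} (h : (1 - M) * F = 1) (h' : (1 - M') * F' = 1)
    (hM : ∀ i j, constantCoeff (M i j) = 0) (hM' : ∀ i j, constantCoeff (M' i j) = 0)
    {a b : ℕ → ℕ} (hab : ∀ n, n ≠ 0 → periodicCount S n + b n = 2 * a n)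
    (ha : countSeries a = X * (M.map (d⁄dX ℚ) * F).trace)
    (hb : countSeries b = X * (M'.map (d⁄dX ℚ) * F').trace) :
    zeta S * (1 - M).det ^ 2 = (1 - M').det := by
  have hc : ∀ {N : Matrix n n ℚ⟦X⟧}, (∀ i j, constantCoeff (N i j) = 0) →
      constantCoeff (1 - N).det = 1 := by
    intro N hN
    rw [RingHom.map_det]
    convert det_one (n := n) (R := ℚ)
    ext i j
    rw [RingHom.mapMatrix_apply, map_apply, Matrix.sub_apply, map_sub, hN, sub_zero, one_apply,
      one_apply]
    split_ifs
    · exact map_one _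
    · exact map_zero _
  have hP : countSeries (periodicCount S) = 2 * countSeries a - countSeries b := by
    rw [show (2 : ℚ⟦X⟧) = C (2 : ℚ) from (map_ofNat C 2).symm]
    ext n
    simp only [countSeries, map_sub, coeff_mk, coeff_C_mul]
    split_ifs with hn
    · simp
    · rw [eq_sub_iff_add_eq]
      exact_mod_cast hab n hn
  have hu : (1 - M').det * (1 - M').det⁻¹ = 1 :=
    PowerSeries.mul_inv_cancel _ (by rw [hc hM']; exact one_ne_zero)
  have hda : X * d⁄dX ℚ (1 - M).det = -((1 - M).det * countSeries a) := by
    rw [derivative_det_one_sub h, ha]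
    ring
  have hdb : X * d⁄dX ℚ (1 - M').det = -((1 - M').det * countSeries b) := by
    rw [derivative_det_one_sub h', hb]
    ring
  have hz := X_mul_derivative_zeta S
  rw [hP] at hz
  suffices hs : zeta S * (1 - M).det ^ 2 * (1 - M').det⁻¹ = 1 by
    linear_combination (1 - M').det * hs - zeta S * (1 - M).det ^ 2 * hu
  -- The logarithmic derivatives of the three factors, times `X`, are 2a - b, -2a and b, so the
  -- product has derivative zero.
  refine derivative.ext ?_ ?_
  · refine mul_left_cancel₀ (X_ne_zero (R := ℚ)) ?_
    simp only [Derivation.leibniz, Derivation.leibniz_pow, derivative_inv', smul_eq_mul,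
      derivative_one, mul_zero, nsmul_eq_mul, Nat.cast_ofNat, pow_one, Nat.add_one_sub_one]
    generalize (1 - M').det⁻¹ = J at *
    linear_combination (1 - M).det ^ 2 * J * hz + 2 * zeta S * (1 - M).det * J * hda -
      zeta S * (1 - M).det ^ 2 * J ^ 2 * hdb + zeta S * (1 - M).det ^ 2 * J * countSeries b * hu
  · rw [map_mul, map_mul, map_pow, constantCoeff_zeta, hc hM, constantCoeff_inv, hc hM', map_one]
    norm_num

end Series

/-! ### The renewal equation for paths -/

open PowerSeries

/-- The words of length `n` in a language. -/
def slice {α : Type*} (L : Language α) (n : ℕ) : Set (List α) := {w | w ∈ L ∧ w.length = n}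

theorem coeff_genFun {α : Type*} (L : Language α) (n : ℕ) :
    coeff n (genFun L) = ((slice L n).ncard : ℚ) := by
  rw [genFun, coeff_mk]
  rfl

instance [Finite E] : Finite (Letter E) :=
  Finite.of_surjective (Sum.elim Letter.neg Letter.pos : E ⊕ E → Letter E) fun x => by
    cases x with
    | neg e => exact ⟨.inl e, rfl⟩
    | pos e => exact ⟨.inr e, rfl⟩

theorem slice_finite {α : Type*} [Finite α] (L : Language α) (n : ℕ) : (slice L n).Finite :=
  (List.finite_length_eq α n).subset fun _ h => h.2

namespace DirectedGraph

variable {G : DirectedGraph V E}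

theorem cons_mem_paths_univ {e : E} {v : V} {w : List (Letter E)}
    (h : w ∈ G.paths Set.univ (G.r e) v) : .neg e :: w ∈ G.paths Set.univ (G.s e) v := by
  refine ⟨run_append_paths (w := [.neg e]) (a := G.r e) ⟨[e], ?_⟩ h.1, trivial⟩
  exact ⟨_, ⟨_, rfl, rfl⟩, rfl⟩

theorem append_mem_paths {H : Set ℤ} {u v : V} {c w : List (Letter E)} (hc : c ∈ G.code u)
    (h : w ∈ G.paths H u v) : c ++ w ∈ G.paths H u v := by
  refine ⟨run_append_paths ⟨_, (mem_code.1 hc).2.1⟩ h.1, ?_⟩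
  rw [ht_append, ht_eq_zero_of_mem_code hc, zero_add]
  exact h.2

/-- Concatenation of a code word and a path is undone by cutting at `gap`. Code words have height 0,
so any `H` is respected. -/
theorem ncard_gap_eq_mul {H : Set ℤ} {u v : V} {n k : ℕ} (hk : k ≠ 1) (hk0 : k ≠ 0) (hn : k ≤ n) :
    {w | w ∈ slice (G.paths H u v) n ∧ gap w = k}.ncard =
      (slice (G.code u) k).ncard * (slice (G.paths H u v) (n - k)).ncard := by
  rw [← Set.ncard_prod, eq_comm]
  refine Set.ncard_congr (fun p _ => p.1 ++ p.2) ?_ ?_ ?_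
  · rintro ⟨c, w⟩ ⟨⟨hc, hcl⟩, hw, hwl⟩
    refine ⟨⟨append_mem_paths hc hw, ?_⟩, ?_⟩
    · simp at hcl hwl ⊢
      omega
    · rw [gap_code_append hc (dominant_of_mem_paths hw)]
      exact hcl
  · rintro ⟨c, w⟩ ⟨c', w'⟩ ⟨⟨-, hcl⟩, -⟩ ⟨⟨-, hcl'⟩, -⟩ h
    exact Prod.ext_iff.2 (List.append_inj h (hcl.trans hcl'.symm))
  · rintro w ⟨⟨⟨⟨q, hw⟩, hH⟩, hl⟩, rfl⟩
    have hw0 : w ≠ [] := by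
      rintro rfl
      simp at hl
      omega
    obtain ⟨h1, h2⟩ := exists_eq_append_of_gap_ne_one hw hw0 hk
    refine ⟨(w.take (gap w), w.drop (gap w)), ⟨⟨h1, ?_⟩, ⟨h2, ?_⟩, ?_⟩, List.take_append_drop _ _⟩
    · simp [hl, hn]
    · have := ht_append (w.take (gap w)) (w.drop (gap w))
      rw [List.take_append_drop, ht_eq_zero_of_mem_code h1, zero_add] at this
      rwa [← this]
    · simp [hl]

/-- Removing the first edge lowers the height by 1, which is why all heights are allowed here. -/
theorem ncard_gap_eq_one [Fintype V] [Finite E] {u v : V} {n : ℕ} (hn : 1 ≤ n) :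
    {w | w ∈ slice (G.paths Set.univ u v) n ∧ gap w = 1}.ncard =
      ∑ a, G.adjMatrix u a * (slice (G.paths Set.univ a v) (n - 1)).ncard := by
  have : ∀ a, Finite (slice (G.paths Set.univ a v) (n - 1)) := fun a =>
    (slice_finite _ _).to_subtype
  have hs : ∀ a, G.adjMatrix u a * (slice (G.paths Set.univ a v) (n - 1)).ncard =
      Nat.card ({e : E | G.s e = u ∧ G.r e = a} × slice (G.paths Set.univ a v) (n - 1)) := by
    intro a
    rw [Nat.card_prod]
    rfl
  simp only [hs]
  rw [← Nat.card_sigma, ← Nat.card_coe_set_eq, eq_comm]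
  refine Nat.card_congr (Equiv.ofBijective (fun p => ⟨.neg p.2.1.1 :: p.2.2.1, ?_⟩) ⟨?_, ?_⟩)
  · obtain ⟨a, ⟨e, rfl, rfl⟩, w, hw, hl⟩ := p
    refine ⟨⟨cons_mem_paths_univ hw, ?_⟩, gap_cons_of_dominant _ (dominant_of_mem_paths hw)⟩
    simp only [List.length_cons] at hl ⊢
    omega
  · rintro ⟨a, ⟨e, rfl, rfl⟩, w, hw⟩ ⟨a', ⟨e', h1, rfl⟩, w', hw'⟩ h
    simp only [Subtype.mk.injEq, List.cons.injEq, Letter.neg.injEq] at h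
    obtain ⟨rfl, rfl⟩ := h
    rfl
  · rintro ⟨w, ⟨⟨⟨q, hw⟩, -⟩, hl⟩, hg⟩
    have hw0 : w ≠ [] := by
      rintro rfl
      simp at hl
      omega
    obtain ⟨e, w', rfl, h, rfl⟩ := exists_eq_cons_of_gap_eq_one hw hw0 hg
    refine ⟨⟨G.r e, ⟨e, rfl, rfl⟩, w', ⟨h, trivial⟩, ?_⟩, rfl⟩
    simp at hl
    omega

theorem gap_ne_one_of_ht_eq_zero {u v : V} {w : List (Letter E)} (h : w ∈ G.paths {0} u v)
    (hw : w ≠ []) : gap w ≠ 1 := by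
  intro hg
  obtain ⟨⟨q, h1⟩, h2⟩ := h
  obtain ⟨e, w', rfl, ⟨q', h3⟩, rfl⟩ := exists_eq_cons_of_gap_eq_one h1 hw hg
  have := h3.dominant.ht_nonneg
  rw [Set.mem_singleton_iff, ht_cons, Letter.ht] at h2
  omega

theorem slice_code_of_lt {u : V} {k : ℕ} (hk : k < 2) : slice (G.code u) k = ∅ := by
  refine Set.eq_empty_of_forall_notMem fun w ⟨hw, hl⟩ => ?_
  have := two_le_length_of_mem_code hw
  omega

variable (G)

/-- The matrix of generating functions of the languages `G.paths H u v`. -/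
noncomputable def pathsMatrix (H : Set ℤ) : Matrix V V ℚ⟦X⟧ :=
  Matrix.of fun u v => genFun (G.paths H u v)

/-- `M` is the generating function of the initial pieces of the paths with height in `H`. -/
def IsPieceMatrix [Fintype V] (H : Set ℤ) (M : Matrix V V ℚ⟦X⟧) : Prop :=
  ∀ u v n k, k ≤ n → k ≠ 0 →
    ({w | w ∈ slice (G.paths H u v) n ∧ gap w = k}.ncard : ℚ) =
      ∑ a, coeff k (M u a) * coeff (n - k) (G.pathsMatrix H a v)

theorem coeff_adjMatrixZ (k : ℕ) (u a : V) :
    coeff k (G.adjMatrixZ u a) = if k = 1 then (G.adjMatrix u a : ℚ) else 0 := by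
  rw [adjMatrixZ, Matrix.of_apply, ← map_natCast (C (R := ℚ)), coeff_C_mul, coeff_X]
  simp

theorem slice_paths_zero [DecidableEq V] {H : Set ℤ} (hH : 0 ∈ H) (u v : V) :
    (slice (G.paths H u v) 0).ncard = if u = v then 1 else 0 := by
  split_ifs with h
  · subst h
    rw [Set.ncard_eq_one]
    refine ⟨[], Set.eq_singleton_iff_unique_mem.2 ⟨⟨⟨⟨[], rfl⟩, hH⟩, rfl⟩, ?_⟩⟩
    rintro w ⟨-, h⟩
    exact List.length_eq_zero_iff.1 h
  · have : slice (G.paths H u v) 0 = ∅ := by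
      refine Set.eq_empty_of_forall_notMem fun w ⟨⟨⟨q, h1⟩, _⟩, h2⟩ => h ?_
      obtain rfl := List.length_eq_zero_iff.1 h2
      exact (Prod.mk.inj h1).1
    rw [this, Set.ncard_empty]

theorem ncard_slice_eq_sum_gap [Finite E] (H : Set ℤ) (u v : V) {n : ℕ} (hn : n ≠ 0) (f : ℕ → ℚ) :
    ∑ w ∈ (slice_finite (G.paths H u v) n).toFinset, f (gap w) =
      ∑ k ∈ Finset.Icc 1 n, f k * ({w | w ∈ slice (G.paths H u v) n ∧ gap w = k}.ncard : ℚ) := by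
  classical
  rw [← Finset.sum_fiberwise_of_maps_to (t := Finset.Icc 1 n) (g := gap)]
  · refine Finset.sum_congr rfl fun k _ => ?_
    rw [Finset.sum_congr rfl (g := fun _ => f k) fun w hw => by rw [(Finset.mem_filter.1 hw).2],
      Finset.sum_const, nsmul_eq_mul, mul_comm, ← Set.ncard_coe_finset]
    congr 3
    ext w
    simp
  · intro w hw
    rw [Set.Finite.mem_toFinset] at hw
    have : w ≠ [] := by
      rintro rfl
      exact hn hw.2.symm
    exact Finset.mem_Icc.2 ⟨(gap_spec w).1, (gap_le_length this).trans_eq hw.2⟩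

theorem coeff_dMatrix [DecidableEq V] (k : ℕ) (u a : V) :
    coeff k (G.dMatrix u a) = if u = a then ((slice (G.code u) k).ncard : ℚ) else 0 := by
  rw [dMatrix, Matrix.diagonal_apply]
  split_ifs
  · exact coeff_genFun _ _
  · simp

variable [Fintype V]

theorem isPieceMatrix_univ [DecidableEq V] [Finite E] :
    G.IsPieceMatrix Set.univ (G.dMatrix + G.adjMatrixZ) := by
  intro u v n k hn hk
  simp only [Matrix.add_apply, map_add, coeff_dMatrix, coeff_adjMatrixZ, pathsMatrix,
    Matrix.of_apply, coeff_genFun]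
  by_cases h1 : k = 1
  · subst h1
    rw [ncard_gap_eq_one hn, slice_code_of_lt one_lt_two]
    simp
  · rw [ncard_gap_eq_mul h1 hk hn]
    simp [h1]

theorem isPieceMatrix_zero [DecidableEq V] : G.IsPieceMatrix {0} G.dMatrix := by
  intro u v n k hn hk
  simp only [coeff_dMatrix, pathsMatrix, Matrix.of_apply, coeff_genFun]
  by_cases h1 : k = 1
  · subst h1
    have : {w | w ∈ slice (G.paths {0} u v) n ∧ gap w = 1} = ∅ := by
      refine Set.eq_empty_of_forall_notMem fun w ⟨⟨h1, h2⟩, h3⟩ => ?_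
      refine gap_ne_one_of_ht_eq_zero h1 ?_ h3
      rintro rfl
      simp at h2
      omega
    rw [this, slice_code_of_lt one_lt_two]
    simp
  · rw [ncard_gap_eq_mul h1 hk hn]
    simp

variable {G}

/-- The weight `f = 1` yields the renewal equation, and `f k = k` turns `M` into `z M'`. -/
theorem sum_gap_eq_coeff [Finite E] {H : Set ℤ} {M : Matrix V V ℚ⟦X⟧} (hM : G.IsPieceMatrix H M)
    (hM0 : ∀ i j, constantCoeff (M i j) = 0) (u v : V) {n : ℕ} (hn : n ≠ 0) (f : ℕ → ℚ) :
    ∑ w ∈ (slice_finite (G.paths H u v) n).toFinset, f (gap w) =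
      ∑ a, ∑ p ∈ Finset.HasAntidiagonal.antidiagonal n,
        f p.1 * coeff p.1 (M u a) * coeff p.2 (G.pathsMatrix H a v) := by
  rw [ncard_slice_eq_sum_gap G H u v hn, Finset.sum_comm,
    Finset.Nat.sum_antidiagonal_eq_sum_range_succ_mk]
  -- The extra term `k = 0` vanishes because `M` has zero constant coefficients.
  refine Finset.sum_subset_zero_on_sdiff (fun k hk => ?_) (fun k hk => ?_) fun k hk => ?_
  · rw [Finset.mem_Icc] at hk
    exact Finset.mem_range.2 (by omega)
  · obtain rfl : k = 0 := by
      simp at hk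
      omega
    simp [hM0]
  · rw [Finset.mem_Icc] at hk
    rw [hM u v n k hk.2 (by omega), Finset.mul_sum]
    exact Finset.sum_congr rfl fun a _ => (mul_assoc _ _ _).symm

theorem one_sub_mul_pathsMatrix [DecidableEq V] [Finite E] {H : Set ℤ} (hH : 0 ∈ H)
    {M : Matrix V V ℚ⟦X⟧} (hM : G.IsPieceMatrix H M) (hM0 : ∀ i j, constantCoeff (M i j) = 0) :
    (1 - M) * G.pathsMatrix H = 1 := by
  rw [sub_mul, one_mul, sub_eq_iff_eq_add]
  ext u v n
  by_cases hn : n = 0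
  · subst hn
    rw [pathsMatrix, Matrix.of_apply, coeff_genFun, slice_paths_zero G hH, Matrix.add_apply,
      Matrix.mul_apply]
    simp [hM0, Matrix.one_apply, apply_ite]
  · have h1 := sum_gap_eq_coeff hM hM0 u v hn fun _ => 1
    rw [Finset.sum_const, ← Set.ncard_eq_toFinset_card _ (slice_finite _ _), nsmul_one] at h1
    rw [Matrix.add_apply, Matrix.mul_apply, map_add, map_sum]
    simp only [coeff_mul]
    simp only [one_mul] at h1
    rw [← h1, pathsMatrix, Matrix.of_apply, coeff_genFun]
    simp [Matrix.one_apply, apply_ite, coeff_one, hn]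

theorem sum_gap_eq_coeff_derivative [Finite E] {H : Set ℤ} {M : Matrix V V ℚ⟦X⟧}
    (hM : G.IsPieceMatrix H M) (hM0 : ∀ i j, constantCoeff (M i j) = 0) {n : ℕ} (hn : n ≠ 0) :
    ((∑ v, ∑ w ∈ (slice_finite (G.paths H v v) n).toFinset, gap w : ℕ) : ℚ) =
      coeff n (X * (M.map (d⁄dX ℚ) * G.pathsMatrix H).trace) := by
  push_cast
  rw [Matrix.trace, Finset.mul_sum, map_sum]
  refine Finset.sum_congr rfl fun v _ => ?_
  rw [sum_gap_eq_coeff hM hM0 v v hn fun k => (k : ℚ), Matrix.diag, Matrix.mul_apply,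
    Finset.mul_sum, map_sum]
  refine Finset.sum_congr rfl fun a _ => ?_
  rw [← mul_assoc, coeff_mul]
  refine Finset.sum_congr rfl fun p _ => ?_
  congr 1
  rcases p with ⟨k | k, l⟩
  · simp
  · rw [coeff_succ_X_mul, Matrix.map_apply, coeff_derivative]
    push_cast
    ring

end DirectedGraph

/-! ### Subwords of periodic sequences -/

/-- The subword of length `k` of a bi-infinite sequence that starts at position `i`. -/
def word {α : Type*} (x : ℤ → α) (i : ℤ) (k : ℕ) : List α :=
  List.ofFn fun j : Fin k => x (i + (j : ℕ))

section Word

variable {α : Type*} (x : ℤ → α)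

@[simp] theorem length_word (i : ℤ) (k : ℕ) : (word x i k).length = k := by simp [word]

@[simp] theorem word_zero (i : ℤ) : word x i 0 = [] := by simp [word]

theorem word_succ (i : ℤ) (k : ℕ) : word x i (k + 1) = x i :: word x (i + 1) k := by
  simp [word, List.ofFn_succ, add_comm, add_left_comm]

theorem word_one (i : ℤ) : word x i 1 = [x i] := by simp [word_succ]

theorem word_add (i : ℤ) (k l : ℕ) : word x i (k + l) = word x i k ++ word x (i + k) l := by
  induction k generalizing i with
  | zero => simp
  | succ k ih =>
    rw [Nat.succ_add, word_succ, ih, word_succ, List.cons_append,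
      show i + 1 + (k : ℤ) = i + (k + 1 : ℕ) by push_cast; ring]

theorem word_translate (m i : ℤ) (k : ℕ) : word (fun t => x (t + m)) i k = word x (i + m) k := by
  simp [word, add_right_comm]

theorem take_word (i : ℤ) {k n : ℕ} (h : k ≤ n) : (word x i n).take k = word x i k := by
  obtain ⟨l, rfl⟩ := Nat.exists_eq_add_of_le h
  rw [word_add, List.take_left' (by simp)]

theorem drop_word (i : ℤ) {k n : ℕ} (h : k ≤ n) :
    (word x i n).drop k = word x (i + k) (n - k) := by
  obtain ⟨l, rfl⟩ := Nat.exists_eq_add_of_le h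
  rw [word_add, List.drop_left' (by simp), Nat.add_sub_cancel_left]

variable {x} {n : ℕ}

theorem periodic_mul (hx : ∀ i, x (i + n) = x i) (m i : ℤ) : x (i + m * n) = x i := by
  have := Function.Periodic.int_mul (f := x) (c := (n : ℤ)) hx m
  simpa using this i

theorem word_periodic_mul (hx : ∀ i, x (i + n) = x i) (m i : ℤ) (k : ℕ) :
    word x (i + m * n) k = word x i k := by
  have : word x (i + m * n) k = word (fun t => x (t + m * n)) i k := (word_translate _ _ _ _).symm
  rw [this]
  simp only [periodic_mul hx]

theorem word_periodic (hx : ∀ i, x (i + n) = x i) (i : ℤ) (k : ℕ) :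
    word x (i + n) k = word x i k := by
  simpa using word_periodic_mul hx 1 i k

theorem apply_eq_getElem_word (hx : ∀ i, x (i + n) = x i) (hn : n ≠ 0) (i t : ℤ) :
    (word x i n)[((t - i) % n).toNat]? = some (x t) := by
  have h0 : (n : ℤ) ≠ 0 := by exact_mod_cast hn
  have h1 := Int.emod_nonneg (t - i) h0
  have h2 := Int.emod_lt_of_pos (t - i) (by omega : (0 : ℤ) < n)
  rw [word, List.getElem?_ofFn, dif_pos (by omega)]
  simp only [Option.some.injEq]
  rw [Int.toNat_of_nonneg h1, ← periodic_mul hx ((t - i) / n)]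
  congr 1
  linarith [Int.emod_add_mul_ediv (t - i) n]

theorem eq_of_word_eq {y : ℤ → α} (hx : ∀ i, x (i + n) = x i) (hy : ∀ i, y (i + n) = y i)
    (hn : n ≠ 0) (i : ℤ) (h : word x i n = word y i n) : x = y := by
  funext t
  have h1 := apply_eq_getElem_word hx hn i t
  rw [h, apply_eq_getElem_word hy hn i t] at h1
  exact (Option.some.inj h1).symm

theorem exists_word_eq {w : List α} (hw : w ≠ []) :
    ∃ x : ℤ → α, (∀ i, x (i + w.length) = x i) ∧ word x 0 w.length = w := by
  have h0 : (0 : ℤ) < w.length := by exact_mod_cast List.length_pos_of_ne_nil hw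
  have hlt : ∀ t : ℤ, (t % w.length).toNat < w.length := fun t => by
    have h1 := Int.emod_nonneg t h0.ne'
    have h2 := Int.emod_lt_of_pos t h0
    omega
  refine ⟨fun t => w[(t % w.length).toNat]'(hlt t), fun i => ?_, ?_⟩
  · simp
  · refine List.ext_getElem (by simp) fun k h1 h2 => ?_
    simp only [word, List.getElem_ofFn, zero_add]
    congr 1
    rw [Int.emod_eq_of_lt (by omega) (by omega)]
    simp

end Word

/-! ### Good positions of a periodic sequence -/

section Height

variable {x : ℤ → Letter E} {n : ℕ}

theorem ht_word_add (x : ℤ → Letter E) (i : ℤ) (k l : ℕ) :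
    ht (word x i (k + l)) = ht (word x i k) + ht (word x (i + k) l) := by
  rw [word_add, ht_append]

theorem ht_word_rotate (hx : ∀ i, x (i + n) = x i) (i : ℤ) :
    ht (word x i n) = ht (word x 0 n) := by
  have h : ∀ i, ht (word x (i + 1) n) = ht (word x i n) := by
    intro i
    have h1 := ht_word_add x i n 1
    have h2 := ht_word_add x i 1 n
    rw [add_comm 1 n, h1, word_one, word_one, hx, Nat.cast_one] at h2
    linarith
  induction i using Int.induction_on with
  | zero => rfl
  | succ i ih => rw [h, ih]
  | pred i ih => rw [← ih, ← h (-(i : ℤ) - 1), sub_add_cancel]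

/-- From the position `i` onwards, the height never falls below its value at `i`. -/
def Good (x : ℤ → Letter E) (i : ℤ) : Prop := ∀ k, 0 ≤ ht (word x i k)

theorem Good.dominant {i : ℤ} (h : Good x i) (k : ℕ) : Dominant (word x i k) := by
  intro t
  rcases le_total t k with ht' | ht'
  · rw [take_word _ _ ht']
    exact h t
  · rw [List.take_of_length_le (by simpa using ht')]
    exact h k

theorem good_translate (m i : ℤ) : Good (fun t => x (t + m)) i ↔ Good x (i + m) := by
  simp only [Good, word_translate]

theorem good_periodic (hx : ∀ i, x (i + n) = x i) {i : ℤ} : Good x (i + n) ↔ Good x i := by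
  simp only [Good, word_periodic hx]

theorem exists_ht_word_le (hx : ∀ i, x (i + n) = x i) (hn : n ≠ 0) {i : ℤ}
    (h : 0 ≤ ht (word x i n)) (t : ℕ) : ∃ r < n, ht (word x i r) ≤ ht (word x i t) := by
  induction t using Nat.strong_induction_on with
  | _ t ih =>
    rcases lt_or_ge t n with h1 | h1
    · exact ⟨t, h1, le_rfl⟩
    · obtain ⟨t, rfl⟩ := Nat.exists_eq_add_of_le h1
      obtain ⟨r, hr, hle⟩ := ih t (by omega)
      refine ⟨r, hr, ?_⟩
      rw [ht_word_add, word_periodic hx]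
      linarith

theorem good_of_dominant (hx : ∀ i, x (i + n) = x i) (hn : n ≠ 0) {i : ℤ}
    (h : Dominant (word x i n)) : Good x i := by
  intro k
  obtain ⟨r, hr, hle⟩ := exists_ht_word_le hx hn (by simpa using h.ht_nonneg) k
  have := h r
  rw [take_word _ _ hr.le] at this
  exact this.trans hle

theorem exists_good (hx : ∀ i, x (i + n) = x i) (hn : n ≠ 0) (h : 0 ≤ ht (word x 0 n)) :
    ∃ j : ℕ, Good x (-j) := by
  obtain ⟨m, hm, hmin⟩ := Finset.exists_min_image (Finset.range n) (fun r => ht (word x 0 r))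
    ⟨0, by simpa using Nat.pos_of_ne_zero hn⟩
  rw [Finset.mem_range] at hm
  -- The minimum of the height over one period is a good position; one period earlier it is
  -- negative.
  refine ⟨n - m, ?_⟩
  rw [← good_periodic hx, show -((n - m : ℕ) : ℤ) + n = (0 : ℤ) + m by omega]
  intro t
  obtain ⟨r, hr, hle⟩ := exists_ht_word_le hx hn h (m + t)
  have h1 := hmin r (by simpa using hr)
  rw [ht_word_add] at hle
  linarith

/-- Only the rest of the current period needs checking: the next one starts at a translate of the
good position `i`. -/
theorem good_add_iff (hx : ∀ i, x (i + n) = x i) {i : ℤ} (h : Good x i) {k : ℕ} (hk : k ≤ n) :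
    Good x (i + k) ↔ Dominant ((word x i n).drop k) := by
  rw [drop_word _ _ hk]
  refine ⟨fun h' => h'.dominant _, fun h' t => ?_⟩
  rcases le_total t (n - k) with h1 | h1
  · simpa [take_word _ _ h1] using h' t
  · obtain ⟨t, rfl⟩ := Nat.exists_eq_add_of_le h1
    rw [ht_word_add]
    refine add_nonneg h'.ht_nonneg ?_
    rw [show i + k + ((n - k : ℕ) : ℤ) = i + n by omega, word_periodic hx]
    exact h t

end Height

/-! ### Counting periodic points by closed paths -/

namespace DirectedGraph

variable (G : DirectedGraph V E)

theorem mem_shift {x : ℤ → Letter E} : x ∈ G.shift ↔ ∀ i k, G.Admissible (word x i k) := Iff.rfl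

theorem translate_mem_shift {x : ℤ → Letter E} (hx : x ∈ G.shift) (m : ℤ) :
    (fun t => x (t + m)) ∈ G.shift := by
  intro i k
  have := hx (i + m) k
  rwa [← word, ← word_translate] at this

/-- The points of the Markov-Dyck shift with period `n` whose height over a period is in `H`. -/
def periodicPoints (H : Set ℤ) (n : ℕ) : Set (ℤ → Letter E) :=
  {x | x ∈ G.shift ∧ (∀ i : ℤ, x (i + n) = x i) ∧ ht (word x 0 n) ∈ H}

variable {G}

theorem word_mem_paths {x : ℤ → Letter E} (hx : x ∈ G.shift) {n : ℕ}
    (hp : ∀ i : ℤ, x (i + n) = x i) (hn : n ≠ 0) {i : ℤ} (hi : Good x i) {H : Set ℤ}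
    (hH : ht (word x i n) ∈ H) :
    word x i n ∈ G.paths H (G.src (x i)) (G.src (x i)) := by
  obtain ⟨k, rfl⟩ := Nat.exists_eq_succ_of_ne_zero hn
  -- Two periods are read so that the vertex reached after the first is the source of the same
  -- letter `x i`, which closes the path.
  have h := (G.admissible_iff _).1 (G.mem_shift.1 hx i (k + 1 + (k + 1)))
  rw [word_add, word_periodic hp] at h
  rcases h with h | ⟨⟨a, l⟩, t, h⟩
  · simp [word_succ] at h
  · obtain ⟨⟨b, m⟩, h1, h2⟩ := (run_append G).1 h
    have ha : G.src (x i) = a := by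
      rw [word_succ] at h1
      exact h1.src
    have hb : G.src (x i) = b := by
      rw [word_succ] at h2
      exact h2.src
    obtain ⟨q, -, h3⟩ := h1.of_dominant (hi.dominant _)
    rw [← ha, ← hb] at h3
    exact ⟨⟨q, h3⟩, hH⟩

theorem mem_shift_of_word_mem_paths {x : ℤ → Letter E} {n : ℕ} (hp : ∀ i : ℤ, x (i + n) = x i)
    (hn : n ≠ 0) {H : Set ℤ} {v : V} (h : word x 0 n ∈ G.paths H v v) : x ∈ G.shift := by
  have hpow : ∀ m : ℕ, ∃ q, G.Run (word x 0 (m * n)) (v, []) (v, q) := by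
    intro m
    induction m with
    | zero => exact ⟨[], by simp⟩
    | succ m ih =>
      rw [Nat.succ_mul, add_comm, word_add, word_periodic hp]
      exact run_append_paths h.1 ih
  intro i k
  change G.Admissible (word x i k)
  -- Shifting by `|i|` periods makes the starting position non-negative, so the subword lies in a
  -- power of the closed path.
  obtain ⟨t, ht'⟩ : ∃ t : ℕ, (t : ℤ) = i + i.natAbs * n := by
    refine ⟨(i + i.natAbs * n).toNat, Int.toNat_of_nonneg ?_⟩
    have : (1 : ℤ) ≤ n := by omega
    have : (i.natAbs : ℤ) ≤ i.natAbs * n := le_mul_of_one_le_right (by omega) this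
    omega
  rw [admissible_iff, ← word_periodic_mul hp i.natAbs, ← ht']
  right
  obtain ⟨q, hq⟩ := hpow (t + k)
  have hle : t + k ≤ (t + k) * n := Nat.le_mul_of_pos_right _ (Nat.pos_of_ne_zero hn)
  obtain ⟨l, hl⟩ := Nat.exists_eq_add_of_le hle
  rw [hl, word_add, run_append, word_add] at hq
  obtain ⟨m, hm, -⟩ := hq
  rw [run_append, zero_add] at hm
  obtain ⟨m', -, hm'⟩ := hm
  exact ⟨_, _, hm'⟩

/-- A form of the cycle lemma. With `-j` the last good position ≤ 0 and `w` the period read from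
there, the next good position is `-j + gap w` and must be positive, so `j < gap w`. Conversely,
repeat `w` and translate by `j`. -/
theorem ncard_periodicPoints [Fintype V] [Finite E] {H : Set ℤ} (hH : H ⊆ Set.Ici 0) {n : ℕ}
    (hn : n ≠ 0) : (G.periodicPoints H n).ncard =
      ∑ v, ∑ w ∈ (slice_finite (G.paths H v v) n).toFinset, gap w := by
  classical
  have hcard : ∑ v, ∑ w ∈ (slice_finite (G.paths H v v) n).toFinset, gap w =
      (Finset.univ.sigma fun v => (slice_finite (G.paths H v v) n).toFinset.sigma
        fun w => Finset.range (gap w)).card := by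
    simp only [Finset.card_sigma, Finset.card_range]
  rw [hcard, ← Set.ncard_coe_finset]
  have hgood : ∀ x ∈ G.periodicPoints H n, Good x (-(sInf {j : ℕ | Good x (-j)} : ℕ)) :=
    fun x hx => Nat.sInf_mem (s := {j : ℕ | Good x (-j)}) (exists_good hx.2.1 hn (hH hx.2.2))
  refine Set.ncard_congr (fun x _ => ⟨G.src (x (-(sInf {j : ℕ | Good x (-j)} : ℕ))),
    word x (-(sInf {j : ℕ | Good x (-j)} : ℕ)) n, sInf {j : ℕ | Good x (-j)}⟩) ?_ ?_ ?_
  · intro x hx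
    have hg := hgood x hx
    have hmin : ∀ j : ℕ, Good x (-j) → sInf {j : ℕ | Good x (-j)} ≤ j := fun j hj =>
      Nat.sInf_le hj
    revert hg hmin
    generalize sInf {j : ℕ | Good x (-j)} = j
    intro hg hmin
    have hw := word_mem_paths hx.1 hx.2.1 hn hg (H := H)
      (by rw [ht_word_rotate hx.2.1]; exact hx.2.2)
    simp only [Finset.coe_sigma, Set.mem_sigma_iff, Finset.coe_univ, Set.mem_univ, true_and,
      Set.Finite.coe_toFinset, Finset.coe_range, Set.mem_Iio]
    refine ⟨⟨hw, length_word _ _ _⟩, ?_⟩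
    by_contra! hlt
    obtain ⟨h1, h2⟩ := gap_spec (word x (-j) n)
    have hle := gap_le_length (w := word x (-j) n) (List.ne_nil_of_length_pos (by simp; omega))
    rw [length_word] at hle
    have h3 := (good_add_iff hx.2.1 hg hle).2 h2
    have h4 := hmin (j - gap (word x (-j) n)) (by convert h3 using 1; omega)
    omega
  · intro x y hx hy h
    simp only [Sigma.mk.injEq, heq_eq_eq] at h
    obtain ⟨-, h1, h2⟩ := h
    rw [← h2] at h1
    exact eq_of_word_eq hx.2.1 hy.2.1 hn _ h1
  · rintro ⟨v, w, j⟩ h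
    simp only [Finset.coe_sigma, Set.mem_sigma_iff, Finset.coe_univ, Set.mem_univ, true_and,
      Set.Finite.coe_toFinset, Finset.coe_range, Set.mem_Iio] at h
    obtain ⟨⟨hw, rfl⟩, hj⟩ := h
    have hw0 : w ≠ [] := by
      rintro rfl
      exact hn rfl
    obtain ⟨y, hy, hyw⟩ := exists_word_eq hw0
    generalize hlen : w.length = n at *
    subst hyw
    have hg : Good y 0 := good_of_dominant hy hn (dominant_of_mem_paths hw)
    have hsrc : G.src (y 0) = v := by
      obtain ⟨k, rfl⟩ := Nat.exists_eq_succ_of_ne_zero hn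
      obtain ⟨⟨q, h⟩, -⟩ := hw
      rw [word_succ] at h
      exact h.src
    have hper : ∀ i : ℤ, y (i + n + j) = y (i + j) := fun i => by
      rw [add_right_comm, hy]
    -- A smaller offset `i` would give a good position `j - i` of `y` strictly between 0 and `gap
    -- w`.
    have hinf : sInf {i : ℕ | Good (fun t => y (t + j)) (-i)} = j := by
      simp only [good_translate]
      refine le_antisymm (Nat.sInf_le (by simpa using hg)) ?_
      have hmem : Good y (-(sInf {i : ℕ | Good y (-i + j)} : ℕ) + j) :=
        Nat.sInf_mem (s := {i : ℕ | Good y (-i + j)}) ⟨j, by simpa using hg⟩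
      revert hmem
      generalize sInf {i : ℕ | Good y (-i + j)} = i
      intro hmem
      by_contra! hlt
      have hgl := gap_le_length hw0
      rw [length_word] at hgl
      have := (good_add_iff hy hg (k := j - i) (by omega)).1 (by convert hmem using 1; omega)
      have := gap_le (by omega) this
      omega
    refine ⟨fun t => y (t + j), ⟨G.translate_mem_shift (mem_shift_of_word_mem_paths hy hn hw) j,
      hper, ?_⟩, ?_⟩
    · rw [word_translate, ht_word_rotate hy]
      exact hw.2
    · simp only [hinf, word_translate, neg_add_cancel, hsrc]

end DirectedGraph

/-! ### Time reversal -/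

/-- The involution that exchanges `e⁻` and `e⁺`. -/
def Letter.flip : Letter E → Letter E
  | .neg e => .pos e
  | .pos e => .neg e

theorem Letter.flip_flip (x : Letter E) : x.flip.flip = x := by cases x <;> rfl

theorem Letter.ht_flip (x : Letter E) : x.flip.ht = -x.ht := by cases x <;> rfl

/-- The time reversal of a bi-infinite sequence. -/
def reversal (x : ℤ → Letter E) : ℤ → Letter E := fun i => (x (-i)).flip

theorem reversal_reversal (x : ℤ → Letter E) : reversal (reversal x) = x := by
  funext i
  simp [reversal, Letter.flip_flip]

theorem word_reversal (x : ℤ → Letter E) (i : ℤ) (k : ℕ) :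
    word (reversal x) i k = ((word x (-i - k + 1) k).map Letter.flip).reverse := by
  induction k generalizing i with
  | zero => simp
  | succ k ih =>
    rw [word_succ, ih, show -i - ((k + 1 : ℕ) : ℤ) + 1 = -(i + 1) - k + 1 by push_cast; ring,
      word_add, word_one, show -(i + 1) - (k : ℤ) + 1 + k = -i by ring]
    simp [reversal]

theorem ht_reverse_map_flip (w : List (Letter E)) : ht (w.map Letter.flip).reverse = -ht w := by
  induction w with
  | nil => simp
  | cons x w ih =>
    rw [List.map_cons, List.reverse_cons, ht_append, ih, ht_cons, ht_cons, Letter.ht_flip]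
    simp

namespace DirectedGraph

variable {G : DirectedGraph V E}

theorem step_flip {x : Letter E} {s t : V × List E} : G.Step x.flip s t ↔ G.Step x t s := by
  cases x <;> exact exists_congr fun l => and_comm

/-- Push and pop of the same edge are converse relations. -/
theorem run_reverse_map_flip {w : List (Letter E)} {s t : V × List E} :
    G.Run (w.map Letter.flip).reverse s t ↔ G.Run w t s := by
  induction w generalizing t with
  | nil => exact eq_comm
  | cons x w ih =>
    rw [List.map_cons, List.reverse_cons, run_append, run_cons]
    refine exists_congr fun m => ?_
    rw [ih, and_comm]
    refine and_congr_left fun _ => ?_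
    simp only [run_cons, run_nil, exists_eq_right]
    exact step_flip

theorem admissible_reverse_map_flip {w : List (Letter E)} (h : G.Admissible w) :
    G.Admissible (w.map Letter.flip).reverse := by
  rw [admissible_iff] at h ⊢
  refine h.imp ?_ ?_
  · rintro rfl
    rfl
  · rintro ⟨s, t, h⟩
    exact ⟨t, s, run_reverse_map_flip.2 h⟩

theorem reversal_mem_periodicPoints {H : Set ℤ} {n : ℕ} {x : ℤ → Letter E}
    (hx : x ∈ G.periodicPoints H n) : reversal x ∈ G.periodicPoints (-H) n := by
  obtain ⟨h1, h2, h3⟩ := hx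
  refine ⟨fun i k => ?_, fun i => ?_, ?_⟩
  · change G.Admissible (word (reversal x) i k)
    rw [word_reversal]
    exact admissible_reverse_map_flip (h1 _ _)
  · rw [reversal, reversal, ← h2, show -(i + (n : ℤ)) + n = -i by ring]
  · rwa [word_reversal, ht_reverse_map_flip, ht_word_rotate h2, Set.mem_neg, neg_neg]

theorem ncard_periodicPoints_neg (H : Set ℤ) (n : ℕ) :
    (G.periodicPoints (-H) n).ncard = (G.periodicPoints H n).ncard := by
  refine (Set.ncard_congr (fun x _ => reversal x) (fun x hx => reversal_mem_periodicPoints hx)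
    (fun x y _ _ h => ?_) fun y hy => ⟨reversal y, ?_, reversal_reversal y⟩).symm
  · rw [← reversal_reversal x, h, reversal_reversal]
  · simpa using reversal_mem_periodicPoints hy

theorem finite_periodicPoints [Finite E] (H : Set ℤ) {n : ℕ} (hn : n ≠ 0) :
    (G.periodicPoints H n).Finite := by
  refine Set.Finite.of_finite_image (f := fun x => word x 0 n)
    ((List.finite_length_eq (Letter E) n).subset ?_) fun x hx y hy h =>
      eq_of_word_eq hx.2.1 hy.2.1 hn 0 h
  rintro _ ⟨x, -, rfl⟩
  exact length_word _ _ _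

/-- Reversal identifies the periodic points of non-positive height with those of non-negative
height. -/
theorem periodicCount_add_ncard [Finite E] {n : ℕ} (hn : n ≠ 0) :
    periodicCount G.shift n + (G.periodicPoints {0} n).ncard =
      2 * (G.periodicPoints (Set.Ici 0) n).ncard := by
  have h1 : {x : ℤ → Letter E | x ∈ G.shift ∧ ∀ i : ℤ, x (i + n) = x i} =
      G.periodicPoints (Set.Ici 0) n ∪ G.periodicPoints (-Set.Ici 0) n := by
    ext x
    simp only [periodicPoints, Set.mem_union, Set.mem_ofPred_eq, ← and_or_left, Set.mem_neg,
      Set.mem_Ici, Left.nonneg_neg_iff, le_total, and_true]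
  have h2 : G.periodicPoints {0} n =
      G.periodicPoints (Set.Ici 0) n ∩ G.periodicPoints (-Set.Ici 0) n := by
    ext x
    simp only [periodicPoints, Set.mem_inter_iff, Set.mem_ofPred_eq, Set.mem_neg,
      Set.mem_Ici, Left.nonneg_neg_iff, Set.mem_singleton_iff]
    constructor
    · rintro ⟨h1, h2, h3⟩
      exact ⟨⟨h1, h2, h3.ge⟩, h1, h2, h3.le⟩
    · rintro ⟨⟨h1, h2, h3⟩, -, -, h4⟩
      exact ⟨h1, h2, le_antisymm h4 h3⟩
  rw [periodicCount, h1, h2, Set.ncard_union_add_ncard_inter _ _ (finite_periodicPoints _ hn)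
    (finite_periodicPoints _ hn), ncard_periodicPoints_neg, two_mul]

/-! ### Identification of the matrices and the final formula -/

theorem paths_Ici (u v : V) : G.paths (Set.Ici 0) u v = G.paths Set.univ u v :=
  Set.ext fun _ => ⟨fun h => ⟨h.1, trivial⟩, fun h => ⟨h.1, h.1.choose_spec.dominant.ht_nonneg⟩⟩

theorem notMem_paths_zero {u v : V} (h : u ≠ v) (w : List (Letter E)) :
    w ∉ G.paths {0} u v := by
  rintro ⟨⟨q, h1⟩, h2⟩
  have hl := h1.length
  rw [h2] at hl
  simp only [List.length_nil, Nat.cast_zero, add_zero, Nat.cast_eq_zero,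
    List.length_eq_zero_iff] at hl
  subst hl
  exact h (G.run_closed h1)

/-- A path of height 0 cannot start with an edge that is never popped, so its initial pieces are
code words; they are peeled off by induction on the length. -/
theorem paths_zero_self (v : V) : G.paths {0} v v = KStar.kstar (G.code v) := by
  ext w
  rw [Language.mem_kstar]
  constructor
  · induction hn : w.length using Nat.strong_induction_on generalizing w with
    | _ n ih =>
      intro h
      by_cases hw : w = []
      · exact ⟨[], by simpa using hw, by simp⟩
      · obtain ⟨⟨q, h1⟩, h2⟩ := id h
        obtain ⟨h3, h4⟩ := exists_eq_append_of_gap_ne_one h1 hw (gap_ne_one_of_ht_eq_zero h hw)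
        have h5 := ht_append (w.take (gap w)) (w.drop (gap w))
        rw [List.take_append_drop, ht_eq_zero_of_mem_code h3, zero_add] at h5
        have h6 := List.length_pos_of_ne_nil hw
        have h7 := (gap_spec w).1
        obtain ⟨L, hL, hL'⟩ := ih _ (by rw [List.length_drop]; omega) (w.drop (gap w)) rfl
          ⟨h4, by rwa [← h5]⟩
        refine ⟨w.take (gap w) :: L, ?_, ?_⟩
        · rw [List.flatten_cons, ← hL, List.take_append_drop]
        · rintro y (- | ⟨_, hy⟩)
          · exact h3
          · exact hL' y hy
  · rintro ⟨L, rfl, hL⟩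
    induction L with
    | nil => exact ⟨⟨[], rfl⟩, rfl⟩
    | cons c L ih =>
      rw [List.flatten_cons]
      exact append_mem_paths (hL c (by simp)) (ih fun y hy => hL y (by simp [hy]))

theorem pathsMatrix_zero [DecidableEq V] : G.pathsMatrix {0} = G.dStarMatrix := by
  ext1 u v
  rw [pathsMatrix, Matrix.of_apply, dStarMatrix, Matrix.diagonal_apply]
  split_ifs with h
  · subst h
    rw [paths_zero_self]
  · ext n
    rw [coeff_genFun]
    simp [slice, notMem_paths_zero h]

theorem countSeries_ncard_periodicPoints [Fintype V] [Finite E] {H : Set ℤ}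
    (hH : H ⊆ Set.Ici 0) {M : Matrix V V ℚ⟦X⟧} (hM : G.IsPieceMatrix H M)
    (hM0 : ∀ i j, constantCoeff (M i j) = 0) :
    countSeries (fun n => (G.periodicPoints H n).ncard) =
      X * (M.map (d⁄dX ℚ) * G.pathsMatrix H).trace := by
  ext n
  rw [countSeries, coeff_mk]
  split_ifs with hn
  · subst hn
    simp
  · rw [← sum_gap_eq_coeff_derivative hM hM0 hn, ncard_periodicPoints hH hn]

variable (G)

theorem constantCoeff_dMatrix [DecidableEq V] (u v : V) : constantCoeff (G.dMatrix u v) = 0 := by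
  rw [← coeff_zero_eq_constantCoeff_apply, coeff_dMatrix, slice_code_of_lt two_pos]
  simp

theorem constantCoeff_adjMatrixZ (u v : V) : constantCoeff (G.adjMatrixZ u v) = 0 := by
  rw [← coeff_zero_eq_constantCoeff_apply, coeff_adjMatrixZ]
  simp

theorem constantCoeff_dMatrix_add_adjMatrixZ [DecidableEq V] (u v : V) :
    constantCoeff ((G.dMatrix + G.adjMatrixZ) u v) = 0 := by
  rw [Matrix.add_apply, map_add, constantCoeff_dMatrix, constantCoeff_adjMatrixZ, add_zero]

variable [Fintype V] [DecidableEq V] [Finite E]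

theorem isPieceMatrix_Ici : G.IsPieceMatrix (Set.Ici 0) (G.dMatrix + G.adjMatrixZ) := by
  simpa only [IsPieceMatrix, pathsMatrix, paths_Ici] using G.isPieceMatrix_univ

theorem one_sub_dMatrix_mul_dStarMatrix : (1 - G.dMatrix) * G.dStarMatrix = 1 := by
  rw [← pathsMatrix_zero]
  exact one_sub_mul_pathsMatrix (Set.mem_singleton 0) G.isPieceMatrix_zero G.constantCoeff_dMatrix

theorem one_sub_mul_pathsMatrix_Ici :
    (1 - (G.dMatrix + G.adjMatrixZ)) * G.pathsMatrix (Set.Ici 0) = 1 :=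
  one_sub_mul_pathsMatrix Set.self_mem_Ici G.isPieceMatrix_Ici
    G.constantCoeff_dMatrix_add_adjMatrixZ

theorem zeta_shift_mul_det_sq :
    zeta G.shift * (1 - (G.dMatrix + G.adjMatrixZ)).det ^ 2 = (1 - G.dMatrix).det := by
  have ha := countSeries_ncard_periodicPoints subset_rfl G.isPieceMatrix_Ici
    G.constantCoeff_dMatrix_add_adjMatrixZ
  have hb := countSeries_ncard_periodicPoints (by simp) G.isPieceMatrix_zero
    G.constantCoeff_dMatrix
  rw [pathsMatrix_zero] at hb
  exact zeta_mul_det_sq G.shift G.one_sub_mul_pathsMatrix_Ici G.one_sub_dMatrix_mul_dStarMatrix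
    G.constantCoeff_dMatrix_add_adjMatrixZ G.constantCoeff_dMatrix
    (fun n hn => periodicCount_add_ncard hn) ha hb

theorem one_sub_genFun_code_mul (a : V) :
    (1 - genFun (G.code a)) * G.dStarMatrix a a = 1 := by
  have := congrFun (congrFun G.one_sub_dMatrix_mul_dStarMatrix a) a
  rw [← Matrix.diagonal_one, dMatrix, Matrix.diagonal_sub, Matrix.diagonal_mul,
    Matrix.diagonal_apply_eq] at this
  exact this

theorem one_sub_eq_mul :
    1 - G.dMatrix - G.adjMatrixZ = (1 - G.dMatrix) * (1 - G.dStarMatrix * G.adjMatrixZ) := by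
  rw [mul_sub, mul_one, ← mul_assoc, one_sub_dMatrix_mul_dStarMatrix, one_mul]

theorem isUnit_det_one_sub : IsUnit (1 - G.dMatrix - G.adjMatrixZ).det := by
  rw [sub_sub]
  exact Matrix.isUnit_det_of_right_inverse G.one_sub_mul_pathsMatrix_Ici

theorem det_one_sub_dMatrix_mul : (1 - G.dMatrix).det * G.dStarMatrix.det = 1 := by
  rw [← Matrix.det_mul, one_sub_dMatrix_mul_dStarMatrix, Matrix.det_one]

theorem isUnit_det_one_sub_dStarMatrix_mul :
    IsUnit (1 - G.dStarMatrix * G.adjMatrixZ).det := by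
  have := G.isUnit_det_one_sub
  rw [one_sub_eq_mul, Matrix.det_mul] at this
  exact isUnit_of_mul_isUnit_right this

end DirectedGraph

end MarkovDyck

theorem theorem2p3 {V E : Type*} [Fintype V] [DecidableEq V] [Finite E]
    (G : MarkovDyck.DirectedGraph V E) :
    (∀ a : V, IsUnit (1 - MarkovDyck.genFun (G.code a)) ∧
      G.dStarMatrix a a = (1 - MarkovDyck.genFun (G.code a))⁻¹) ∧
    IsUnit (((1 - G.dMatrix - G.adjMatrixZ) * (1 - G.dStarMatrix * G.adjMatrixZ)).det) ∧
    IsUnit ((1 - G.dStarMatrix * G.adjMatrixZ).det) ∧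
    MarkovDyck.zeta G.shift =
      (((1 - G.dMatrix - G.adjMatrixZ) * (1 - G.dStarMatrix * G.adjMatrixZ)).det)⁻¹ ∧
    MarkovDyck.zeta G.shift =
      G.dStarMatrix.det * ((1 - G.dStarMatrix * G.adjMatrixZ).det ^ 2)⁻¹ := by
  have hc : ∀ {f : ℚ⟦X⟧}, IsUnit f → PowerSeries.constantCoeff f ≠ 0 := fun h =>
    (PowerSeries.isUnit_iff_constantCoeff.1 h).ne_zero
  have hu := G.isUnit_det_one_sub_dStarMatrix_mul
  have hu' : IsUnit (((1 - G.dMatrix - G.adjMatrixZ) *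
      (1 - G.dStarMatrix * G.adjMatrixZ)).det) := by
    rw [Matrix.det_mul]
    exact G.isUnit_det_one_sub.mul hu
  have hz := G.zeta_shift_mul_det_sq
  have hd := G.det_one_sub_dMatrix_mul
  rw [← sub_sub, G.one_sub_eq_mul, Matrix.det_mul] at hz
  have hz' : MarkovDyck.zeta G.shift * ((1 - G.dMatrix).det *
      (1 - G.dStarMatrix * G.adjMatrixZ).det ^ 2) = 1 := by
    -- Multiplying by `det D*` cancels one of the two factors `det (1 - D)` against the right-hand
    -- side.
    linear_combination G.dStarMatrix.det * hz + (1 - MarkovDyck.zeta G.shift *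
      (1 - G.dMatrix).det * (1 - G.dStarMatrix * G.adjMatrixZ).det ^ 2) * hd
  refine ⟨fun a => ?_, hu', hu, ?_, ?_⟩
  · have h := G.one_sub_genFun_code_mul a
    have h1 := IsUnit.of_mul_eq_one _ h
    exact ⟨h1, (PowerSeries.eq_inv_iff_mul_eq_one (hc h1)).2 (by rw [mul_comm, h])⟩
  · rw [PowerSeries.eq_inv_iff_mul_eq_one (hc hu'), G.one_sub_eq_mul, Matrix.det_mul,
      Matrix.det_mul]
    linear_combination hz'
  · rw [PowerSeries.eq_mul_inv_iff_mul_eq (hc (hu.pow 2))]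
    linear_combination G.dStarMatrix.det * hz' - MarkovDyck.zeta G.shift *
      (1 - G.dStarMatrix * G.adjMatrixZ).det ^ 2 * hd
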